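/- Let $\kappa\in\{1,-1\}$. Let $E$ be either the Fréchet space $C^\infty(\mathbb{T}_L)$ of smooth complex-valued $2L$-periodic functions on the line, for an arbitrary $L>0$, with $\int$ denoting integration over one period $(-L,L]$, or the Schwartz space $\mathcal{S}(\mathbb{R})$ of complex-valued functions, with $\int$ denoting integration over $\mathbb{R}$. Let $E(\mathcal{V})$ be the real topological vector space of matrix-valued functions $$\gamma=\tfrac12\,\mathrm{odiag}(\phi_1,\overline{\phi_2},\phi_2,\overline{\phi_1})=\frac12\begin{pmatrix}0&0&0&\phi_1\\0&0&\overline{\phi_2}&0\\0&\phi_2&0&0\\\overline{\phi_1}&0&0&0\end{pmatrix},\qquad \phi_1,\phi_2\in E,$$ with the symplectic form $$\omega_{L^2,\mathcal{V}}(\gamma,\delta)=2\int \mathrm{tr}\big(J\,\gamma\,\delta_{swap}\big)\,dx,\qquad J=\mathrm{diag}(i,-i,i,-i),$$ where $\delta_{swap}=\tfrac12\mathrm{odiag}(\psi_2,\overline{\psi_1},\psi_1,\overline{\psi_2})$ for $\delta=\tfrac12\mathrm{odiag}(\psi_1,\overline{\psi_2},\psi_2,\overline{\psi_1})$. The symplectic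 gradient $\nabla_{s}F(\gamma)\in E(\mathcal{V})$ of a functional $F:E(\mathcal{V})\to\mathbb{R}$ is the unique element, if it exists, such that the Gâteaux derivative of $F$ at $\gamma$ satisfies $dF[\gamma](\delta)=\omega_{L^2,\mathcal{V}}(\nabla_{s}F(\gamma),\delta)$ for all $\delta\in E(\mathcal{V})$. The algebra $\mathcal{A}_{\mathcal{V}}$ consists of the smooth functionals $F:E(\mathcal{V})\to\mathbb{R}$ which have a symplectic gradient at every point and for which $\nabla_sF:E(\mathcal{V})\to E(\mathcal{V})$ is smooth (smooth meaning that all iterated Gâteaux derivatives exist and are jointly continuous in the point and the directions). The Poisson bracket is $\{F,G\}_{L^2,\mathcal{V}}(\gamma)=\omega_{L^2,\mathcal{V}}(\nabla_sF(\gamma),\nabla_sG(\gamma))$. For functions $\psi_1,\psi_2$ define $w_{1}=\psi_1$ and, for $n\ge1$, $$w_{n+1}=-i\,\partial_xw_{n}+\kappa\,\psi_2\sum_{k=1}^{n-1}w_{k}w_{n-k},\qquad \tilde I_n(\psi_1,\psi_2)=\int\psi_2\,w_{n}\,dx,$$ and $$I_{b,n}(\gamma)=\tfrac12\Big(\tilde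 I_n(\phi_1,\overline{\phi_2})+\tilde I_n(\phi_2,\overline{\phi_1})\Big),\qquad \gamma=\tfrac12\,\mathrm{odiag}(\phi_1,\overline{\phi_2},\phi_2,\overline{\phi_1}).$$ Then for every $n\ge1$ the functional $I_{b,n}$ is real-valued and belongs to $\mathcal{A}_{\mathcal{V}}$, and for all $n,m\ge1$ $$\{I_{b,n},I_{b,m}\}_{L^2,\mathcal{V}}(\gamma)=0\qquad\text{for all }\gamma\in E(\mathcal{V}).$$ -/

import Mathlib

open Filter Topology MeasureTheory
open scoped SchwartzMap ComplexConjugate ContDiff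

noncomputable section

/-! ## Smooth maps between topological vector spaces -/

section Smooth

variable {X Y : Type*} [AddCommGroup X] [Module ℝ X] [TopologicalSpace X]
  [AddCommGroup Y] [Module ℝ Y] [TopologicalSpace Y]

/-- `HasGateauxDeriv f x v y`: the directional derivative of `f` at `x` in direction `v`
exists and equals `y`. -/
def HasGateauxDeriv (f : X → Y) (x v : X) (y : Y) : Prop :=
  Tendsto (fun t : ℝ => t⁻¹ • (f (x + t • v) - f x)) (𝓝[≠] 0) (𝓝 y)

/-- `f` is smooth in the Gâteaux (Michal--Bastiani) sense: it is continuous, and all its iterated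
directional derivatives `D r x (v₁, …, v_r)` exist and are jointly continuous in
`(x; v₁, …, v_r)`. -/
def GateauxSmooth (f : X → Y) : Prop :=
  ∃ D : (r : ℕ) → X → (Fin r → X) → Y,
    (∀ x v, D 0 x v = f x) ∧
    (∀ r, Continuous fun p : X × (Fin r → X) => D r p.1 p.2) ∧
    (∀ r x (v : Fin r → X) u,
      HasGateauxDeriv (fun y => D r y v) x u (D (r + 1) x (Fin.snoc v u)))

end Smooth

/-! ## The Fréchet space of smooth `2L`-periodic functions -/

/-- Smooth functions on the line which are periodic with period `2L`, as a subspace of all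
functions. -/
def periodicSmoothSubmodule (L : ℝ) : Submodule ℂ (ℝ → ℂ) where
  carrier := {f | ContDiff ℝ ∞ f ∧ Function.Periodic f (2 * L)}
  add_mem' := fun ha hb => ⟨ha.1.add hb.1, ha.2.add hb.2⟩
  zero_mem' := ⟨contDiff_const, fun _ => rfl⟩
  smul_mem' := fun c _ hf => ⟨contDiff_const.smul hf.1, hf.2.smul c⟩

/-- The space of smooth functions on the circle `[-L, L]` with periodic boundary conditions. -/
def PeriodicSmooth (L : ℝ) : Type := periodicSmoothSubmodule L

namespace PeriodicSmooth

variable {L : ℝ}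

instance : AddCommGroup (PeriodicSmooth L) :=
  inferInstanceAs (AddCommGroup (periodicSmoothSubmodule L))

instance : Module ℂ (PeriodicSmooth L) :=
  inferInstanceAs (Module ℂ (periodicSmoothSubmodule L))

instance : Module ℝ (PeriodicSmooth L) :=
  inferInstanceAs (Module ℝ (periodicSmoothSubmodule L))

instance : FunLike (PeriodicSmooth L) ℝ ℂ where
  coe f := f.1
  coe_injective := fun _ _ h => Subtype.ext h

theorem contDiff (f : PeriodicSmooth L) : ContDiff ℝ ∞ f := f.2.1

theorem periodic (f : PeriodicSmooth L) : Function.Periodic f (2 * L) := f.2.2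

theorem coe_add (f g : PeriodicSmooth L) : ⇑(f + g) = ⇑f + ⇑g := rfl

theorem coe_smul (c : ℝ) (f : PeriodicSmooth L) : ⇑(c • f) = c • ⇑f := rfl

theorem periodic_iteratedDeriv (f : PeriodicSmooth L) (k : ℕ) :
    Function.Periodic (iteratedDeriv k f) (2 * L) := by
  intro x
  have h : (fun z => f (z + 2 * L)) = f := funext f.periodic
  have h2 := congrFun (iteratedDeriv_comp_add_const k f (2 * L)) x
  rw [h] at h2
  exact h2.symm

theorem bddAbove_iteratedDeriv [hL : Fact (0 < L)] (f : PeriodicSmooth L) (k : ℕ) :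
    BddAbove (Set.range fun x => ‖iteratedDeriv k f x‖) := by
  have hc : Continuous (iteratedDeriv k f) :=
    f.contDiff.continuous_iteratedDeriv k (by exact_mod_cast le_top)
  have hp : Function.Periodic (fun x => ‖iteratedDeriv k f x‖) (2 * L) := fun x => by
    simp only [f.periodic_iteratedDeriv k x]
  have hne : (2 * L) ≠ 0 := by have := hL.out; positivity
  exact (hp.compact_of_continuous hne hc.norm).bddAbove

/-- The seminorm `f ↦ sup_x |∂ₓᵏ f(x)|`. -/
def supSeminorm [Fact (0 < L)] (k : ℕ) : Seminorm ℝ (PeriodicSmooth L) :=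
  Seminorm.of (fun f => ⨆ x, ‖iteratedDeriv k f x‖)
    (fun f g => by
      refine ciSup_le fun x => ?_
      have hf := f.contDiff.contDiffAt (x := x) |>.of_le (m := (k : ℕ∞ω))
        (by exact_mod_cast le_top)
      have hg := g.contDiff.contDiffAt (x := x) |>.of_le (m := (k : ℕ∞ω))
        (by exact_mod_cast le_top)
      rw [coe_add, iteratedDeriv_add hf hg]
      exact (norm_add_le _ _).trans
        (add_le_add (le_ciSup (f.bddAbove_iteratedDeriv k) x)
          (le_ciSup (g.bddAbove_iteratedDeriv k) x)))
    (fun c f => by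
      have h : ∀ x, ‖iteratedDeriv k (⇑(c • f)) x‖ = ‖c‖ * ‖iteratedDeriv k f x‖ := fun x => by
        rw [coe_smul, iteratedDeriv_const_smul_field, norm_smul]
      simp only [h]
      exact (Real.mul_iSup_of_nonneg (norm_nonneg c) _).symm)

/-- The Fréchet topology of uniform convergence of all derivatives. -/
instance [Fact (0 < L)] : TopologicalSpace (PeriodicSmooth L) :=
  SeminormFamily.moduleFilterBasis (𝕜 := ℝ) (supSeminorm (L := L)) |>.topology'

theorem withSeminorms [Fact (0 < L)] : WithSeminorms (supSeminorm (L := L)) := ⟨rfl⟩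

end PeriodicSmooth

/-! ## Mixed states and their symplectic structure -/

/-- The self-adjoint off-diagonal matrix `½ odiag(a, b̄, b, ā)`. -/
def mixedMatrix (a b : ℂ) : Matrix (Fin 4) (Fin 4) ℂ :=
  (1 / 2 : ℂ) • !![0, 0, 0, a; 0, 0, conj b, 0; 0, b, 0, 0; conj a, 0, 0, 0]

/-- The almost complex structure, acting by left multiplication. -/
def matrixJ : Matrix (Fin 4) (Fin 4) ℂ :=
  Matrix.diagonal ![Complex.I, -Complex.I, Complex.I, -Complex.I]

section PhaseSpace

/- `E` is a space of complex functions on the line and `Ω` the domain over which one integrates: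
Schwartz functions with `Ω = ℝ`, or smooth `2L`-periodic functions with `Ω = (-L, L]`.
An element `γ = ½ odiag(φ₁, φ̄₂, φ₂, φ̄₁)` of the phase space of mixed states is recorded by the pair
`(φ₁, φ₂) : E × E`. -/
variable {E : Type*} [FunLike E ℝ ℂ]

/-- The matrix-valued function `γ = ½ odiag(φ₁, φ̄₂, φ₂, φ̄₁)`. -/
def mixedState (γ : E × E) (x : ℝ) : Matrix (Fin 4) (Fin 4) ℂ :=
  mixedMatrix (γ.1 x) (γ.2 x)

/-- The symplectic form `ω(γ, δ) = 2 ∫ tr (J γ δ_swap)`, where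
`δ_swap = ½ odiag(δφ₂, δφ̄₁, δφ₁, δφ̄₂)`. The integrand is real, see `trace_im_eq_zero`. -/
def omegaV (Ω : Set ℝ) (γ δ : E × E) : ℝ :=
  2 * ∫ x in Ω, (Matrix.trace (matrixJ * mixedState γ x * mixedState δ.swap x)).re

theorem trace_mixed (a b c d : ℂ) :
    Matrix.trace (matrixJ * mixedMatrix a b * mixedMatrix d c) =
      (((conj a * d + conj b * c).im / 2 : ℝ) : ℂ) := by
  apply Complex.ext <;>
  simp [Matrix.trace, Fin.sum_univ_four, matrixJ, mixedMatrix, Matrix.mul_apply] <;> ring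

theorem trace_im_eq_zero (γ δ : E × E) (x : ℝ) :
    (Matrix.trace (matrixJ * mixedState γ x * mixedState δ.swap x)).im = 0 := by
  rw [mixedState, mixedState, trace_mixed, Complex.ofReal_im]

/-- `ω(γ, δ) = Im ∫ (φ̄₁ δφ₂ + φ̄₂ δφ₁)`. -/
theorem omegaV_eq (Ω : Set ℝ) (γ δ : E × E) :
    omegaV Ω γ δ = ∫ x in Ω, (conj (γ.1 x) * δ.2 x + conj (γ.2 x) * δ.1 x).im := by
  rw [omegaV, ← integral_const_mul]
  congr 1
  funext x
  rw [mixedState, mixedState, trace_mixed, Complex.ofReal_re]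
  simp only [Prod.fst_swap, Prod.snd_swap]
  ring

variable [AddCommGroup E] [Module ℝ E]

/-- `g` is a symplectic gradient of the functional `F` at `γ`:
`dF[γ](δγ) = ω(g, δγ)` for all directions `δγ`. -/
def IsSympGradAt (Ω : Set ℝ) (F : E × E → ℝ) (γ g : E × E) : Prop :=
  ∀ δ : E × E, Tendsto (fun t : ℝ => t⁻¹ • (F (γ + t • δ) - F γ)) (𝓝[≠] 0) (𝓝 (omegaV Ω g δ))

theorem IsSympGradAt.omegaV_eq_omegaV {Ω : Set ℝ} {F : E × E → ℝ} {γ g h : E × E}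
    (hg : IsSympGradAt Ω F γ g) (hh : IsSympGradAt Ω F γ h) (δ : E × E) :
    omegaV Ω g δ = omegaV Ω h δ :=
  tendsto_nhds_unique (hg δ) (hh δ)

open Classical in
/-- The symplectic gradient of `F` with respect to `ω` (and `0` where there is none). -/
def sympGrad (Ω : Set ℝ) (F : E × E → ℝ) (γ : E × E) : E × E :=
  if h : ∃ g, IsSympGradAt Ω F γ g then h.choose else 0

/-- The Poisson bracket `{F, G}(γ) = ω(∇ₛ F(γ), ∇ₛ G(γ))`. -/
def poissonBracketV (Ω : Set ℝ) (F G : E × E → ℝ) (γ : E × E) : ℝ :=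
  omegaV Ω (sympGrad Ω F γ) (sympGrad Ω G γ)

/-- The admissible algebra: smooth real functionals with a smooth symplectic gradient. -/
def AdmissibleV [TopologicalSpace E] (Ω : Set ℝ) (F : E × E → ℝ) : Prop :=
  GateauxSmooth F ∧ (∀ γ, ∃ g, IsSympGradAt Ω F γ g) ∧ GateauxSmooth (sympGrad Ω F)

end PhaseSpace

/-! ### Uniqueness of symplectic gradients -/

section Uniqueness

variable {E : Type*} [FunLike E ℝ ℂ]

theorem omegaV_left_injective {Ω : Set ℝ}
    (hI : ∀ f g : E, ∃ k : E, ∀ x, k x = Complex.I * (f x - g x))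
    (hint : ∀ f g : E, IntegrableOn (fun x => conj (f x) * g x) Ω)
    (hae : ∀ f g : E, f =ᵐ[volume.restrict Ω] g → f = g)
    {g h : E × E} (H : ∀ δ : E × E, omegaV Ω g δ = omegaV Ω h δ) : g = h := by
  obtain ⟨k₁, hk₁⟩ := hI g.1 h.1
  obtain ⟨k₂, hk₂⟩ := hI g.2 h.2
  have hi : ∀ p : E × E, Integrable
      (fun x => (conj (p.1 x) * k₁ x + conj (p.2 x) * k₂ x).im) (volume.restrict Ω) :=
    fun p => ((hint p.1 k₁).add (hint p.2 k₂)).im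
  have H1 := H (k₂, k₁)
  rw [omegaV_eq, omegaV_eq, ← sub_eq_zero, ← integral_sub (hi g) (hi h)] at H1
  have key : ∀ x, (conj (g.1 x) * k₁ x + conj (g.2 x) * k₂ x).im -
      (conj (h.1 x) * k₁ x + conj (h.2 x) * k₂ x).im =
      Complex.normSq (g.1 x - h.1 x) + Complex.normSq (g.2 x - h.2 x) := fun x => by
    rw [hk₁, hk₂]
    simp [Complex.normSq_apply]
    ring
  have H2 := (integral_eq_zero_iff_of_nonneg (fun x => by
    rw [Pi.zero_apply, Pi.sub_apply, key]
    exact add_nonneg (Complex.normSq_nonneg _) (Complex.normSq_nonneg _))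
    ((hi g).sub (hi h))).1 H1
  have H3 : ∀ᵐ x ∂volume.restrict Ω, g.1 x = h.1 x ∧ g.2 x = h.2 x := by
    filter_upwards [H2] with x hx
    rw [Pi.zero_apply, Pi.sub_apply, key, add_eq_zero_iff_of_nonneg (Complex.normSq_nonneg _) (Complex.normSq_nonneg _),
      Complex.normSq_eq_zero, Complex.normSq_eq_zero, sub_eq_zero, sub_eq_zero] at hx
    exact hx
  exact Prod.ext (hae _ _ (H3.mono fun x hx => hx.1)) (hae _ _ (H3.mono fun x hx => hx.2))

theorem schwartz_omegaV_left_injective {g h : 𝓢(ℝ, ℂ) × 𝓢(ℝ, ℂ)}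
    (H : ∀ δ : 𝓢(ℝ, ℂ) × 𝓢(ℝ, ℂ), omegaV Set.univ g δ = omegaV Set.univ h δ) : g = h := by
  refine omegaV_left_injective (fun f g => ⟨Complex.I • (f - g), fun x => rfl⟩) (fun f g => ?_)
    (fun f g hfg => ?_) H
  · rw [integrableOn_univ]
    have hfg : Integrable (fun x => f x * g x) volume :=
      MemLp.integrable_mul (f.memLp 2 volume) (g.memLp 2 volume)
    refine hfg.norm.mono' ?_ ?_
    · exact ((Complex.continuous_conj.comp f.continuous).mul g.continuous).aestronglyMeasurable
    · refine Eventually.of_forall fun x => ?_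
      simp
  · rw [Measure.restrict_univ] at hfg
    exact DFunLike.coe_injective
      (Continuous.ae_eq_iff_eq volume f.continuous g.continuous |>.1 hfg)

theorem periodic_omegaV_left_injective {L : ℝ} (hL : 0 < L)
    {g h : PeriodicSmooth L × PeriodicSmooth L}
    (H : ∀ δ : PeriodicSmooth L × PeriodicSmooth L,
      omegaV (Set.Ioc (-L) L) g δ = omegaV (Set.Ioc (-L) L) h δ) : g = h := by
  refine omegaV_left_injective (fun f g => ⟨Complex.I • (f - g), fun x => rfl⟩) (fun f g => ?_)
    (fun f g hfg => ?_) H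
  · exact ((Complex.continuous_conj.comp f.contDiff.continuous).mul
      g.contDiff.continuous).integrableOn_Ioc
  · apply DFunLike.coe_injective
    have h2 : Set.EqOn f g (Set.Ioc (-L) L) :=
      Measure.eqOn_Ioc_of_ae_eq volume hfg
        f.contDiff.continuous.continuousOn g.contDiff.continuous.continuousOn
    funext x
    obtain ⟨y, hy, hxy⟩ := (f.periodic.sub g.periodic).exists_mem_Ioc
      (by positivity) x (-L)
    have h3 : f y = g y := h2 ⟨hy.1, by linarith [hy.2]⟩
    have h4 : f x - g x = f y - g y := hxy
    rw [h3, sub_self] at h4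
    exact sub_eq_zero.1 h4

end Uniqueness

/-! ## The functionals -/

/-- The functions `wₙ` attached to the pair `(ψ₁, ψ₂)`, with `w₁ = ψ₁` and
`wₙ₊₁ = -i ∂ₓ wₙ + κ ψ₂ ∑_{k=1}^{n-1} wₖ wₙ₋ₖ` (and the dummy value `w₀ = 0`). -/
def wSeq (κ : ℝ) (ψ₁ ψ₂ : ℝ → ℂ) : ℕ → ℝ → ℂ
  | 0 => fun _ => 0
  | 1 => ψ₁
  | n + 2 => fun x =>
      -Complex.I * deriv (wSeq κ ψ₁ ψ₂ (n + 1)) x +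
        κ * ψ₂ x * ∑ k : Fin n, wSeq κ ψ₁ ψ₂ (k + 1) x * wSeq κ ψ₁ ψ₂ (n - k) x

theorem wSeq_one (κ : ℝ) (ψ₁ ψ₂ : ℝ → ℂ) : wSeq κ ψ₁ ψ₂ 1 = ψ₁ := by
  rw [wSeq]

theorem wSeq_succ (κ : ℝ) (ψ₁ ψ₂ : ℝ → ℂ) {n : ℕ} (hn : 1 ≤ n) (x : ℝ) :
    wSeq κ ψ₁ ψ₂ (n + 1) x =
      -Complex.I * deriv (wSeq κ ψ₁ ψ₂ n) x +
        κ * ψ₂ x * ∑ k ∈ Finset.Icc 1 (n - 1), wSeq κ ψ₁ ψ₂ k x * wSeq κ ψ₁ ψ₂ (n - k) x := by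
  obtain ⟨n, rfl⟩ : ∃ m, n = m + 1 := ⟨n - 1, by omega⟩
  rw [wSeq, Nat.add_sub_cancel]
  have h1 := Fin.sum_univ_eq_sum_range
    (fun k => wSeq κ ψ₁ ψ₂ (k + 1) x * wSeq κ ψ₁ ψ₂ (n - k) x) n
  have h2 := Finset.sum_Ico_add' (fun k => wSeq κ ψ₁ ψ₂ k x * wSeq κ ψ₁ ψ₂ (n + 1 - k) x) 0 n 1
  simp only [Nat.add_sub_add_right, Nat.zero_add, ← Finset.range_eq_Ico] at h2
  simp only [h1, h2]
  rfl

/-- `Ĩₙ(ψ₁, ψ₂) = ∫ ψ₂ wₙ`. -/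
def Itilde (Ω : Set ℝ) (κ : ℝ) (n : ℕ) (ψ₁ ψ₂ : ℝ → ℂ) : ℂ :=
  ∫ x in Ω, ψ₂ x * wSeq κ ψ₁ ψ₂ n x

section Functionals

variable {E : Type*} [FunLike E ℝ ℂ]

/-- `½ (Ĩₙ(φ₁, φ̄₂) + Ĩₙ(φ₂, φ̄₁))`, a priori a complex number. -/
def IbComplex (Ω : Set ℝ) (κ : ℝ) (n : ℕ) (γ : E × E) : ℂ :=
  (1 / 2 : ℂ) * (Itilde Ω κ n γ.1 (fun x => conj (γ.2 x)) +
    Itilde Ω κ n γ.2 (fun x => conj (γ.1 x)))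

/-- The functional `I_{b,n}`, as a real functional. -/
def Ib (Ω : Set ℝ) (κ : ℝ) (n : ℕ) (γ : E × E) : ℝ :=
  (IbComplex Ω κ n γ).re

end Functionals

end

/-! Write $q=\phi_1$, $r=\overline{\phi_2}$ and collect the $w_n$ in a formal power series $W=\sum
w_nX^n$. Their recursion becomes the Riccati equation $W=X(q-iW'+\kappa rW^2)$, where the prime is
$\partial_x$. The conjugate equation $V=X(r+iV'+\kappa qV^2)$ has a solution $V$ of the same kind.
Put $C=WV/(1-\kappa WV)$, $A=V/(1-\kappa WV)$, $B=W/(1-\kappa WV)$; then $C'=-i(qA-rB)$,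
$A=X(r(1+2\kappa C)+iA')$ and $B=X(q(1+2\kappa C)-iB')$.

Since $WA=C$, the equation for $A$ is the transpose of the linearized Riccati equation, with source
$Xr$. Pairing it with a variation $dW$ and integrating by parts shows that the differential of $\int
r w_n$ is $(dq,dr)\mapsto\int(a_n\,dq+b_n\,dr)$ (`integral_variation`). Pairing it instead with the
Euler derivative $X\partial_XW$ gives $n\int r w_n=\int c_{n+1}$. The same computation for $V$ gives
$n\int q v_n=\int c_{n+1}$, so $\int r w_n=\int q v_n$. As conjugation exchanges $W$ and $V$, the
two halves of $I_{b,n}$ are complex conjugates, and $I_{b,n}=\mathrm{Re}\int r w_n$.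

The bracket is therefore the real part of $-i\int(a_nb_m-b_na_m)$. The equations for $A$, $B$, $C$
show that a unit of index can be moved from $n$ to $m$ at the cost of a total derivative
(`integral_commutator_succ`); at $n=0$ the integrand is zero.

Smoothness holds because $w_n$, $a_n$, $b_n$ are polynomials in $q$, $r$ and their derivatives, and
the operations involved are continuous (`PolynomialFamily`). All of this uses only the structure
`SmoothFunctionAlgebra`, which is then built for Schwartz and for periodic functions. -/

noncomputable section

/-! ## Identities for Riccati equations in a commutative ring -/

section RiccatiIdentities

variable {R : Type*} [CommRing R] {i X κ q r W V C W' V' C' : R}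

/-- In $iV\cdot(\text{equation of }W)-iW\cdot(\text{equation of }V)$ the terms without $X$ cancel,
which yields $(WV)'$ after division by $X$. The factor $(1+\kappa C)^2$ with $1+\kappa C=(1-\kappa
WV)^{-1}$ converts $(WV)'$ into $C'$. -/
theorem riccati_deriv_product [IsDomain R] (hX : X ≠ 0) (hi : i * i = -1)
    (hW : W = X * (q - i * W' + κ * r * W ^ 2)) (hV : V = X * (r + i * V' + κ * q * V ^ 2))
    (hC : C = W * V + κ * (W * V * C))
    (hC' : C' = W' * V + W * V' + κ * ((W' * V + W * V') * C + W * V * C')) :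
    C' = -i * (q * (V + κ * (V * C)) - r * (W + κ * (W * C))) := by
  apply mul_left_cancel₀ hX
  have h1 : (1 - κ * (W * V)) * (1 + κ * C) = 1 := by linear_combination κ * hC
  have h2 : X * (W' * V + W * V') = -i * X * (q * V - r * W) * (1 - κ * (W * V)) := by
    linear_combination (-i * V) * hW + (i * W) * hV + (X * (W' * V + W * V')) * hi
  have h3 : C' = (W' * V + W * V') * (1 + κ * C) ^ 2 := by
    linear_combination (-C') * h1 + (1 + κ * C) * hC'
  linear_combination X * h3 + (1 + κ * C) ^ 2 * h2
    + (-i * X * (q * V - r * W) * (1 + κ * C)) * h1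

/-- Multiply the equation of $V$ by $1+\kappa C$. The quadratic term $\kappa qV^2$ is absorbed into
$i\kappa VC'$ by means of the formula for $C'$, and this doubles the coefficient of $\kappa C$ in
front of $r$. -/
theorem riccati_adjoint [IsDomain R] (hX : X ≠ 0) (hi : i * i = -1)
    (hW : W = X * (q - i * W' + κ * r * W ^ 2)) (hV : V = X * (r + i * V' + κ * q * V ^ 2))
    (hC : C = W * V + κ * (W * V * C))
    (hC' : C' = W' * V + W * V' + κ * ((W' * V + W * V') * C + W * V * C')) :
    V + κ * (V * C) =
      X * (r * (1 + 2 * κ * C) + i * (V' + κ * (V' * C + V * C'))) := by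
  have h := riccati_deriv_product hX hi hW hV hC hC'
  linear_combination (1 + κ * C) * hV - (X * i * κ * V) * h - (X * r * κ) * hC
    + (X * κ * V * (q * (V + κ * (V * C)) - r * (W + κ * (W * C)))) * hi

/-- Green's identity for the linearized Riccati operator and its transpose: the last term is
$-i(A\,dW)'$, which integrates to zero. -/
theorem riccati_variation {A A' dq dr dW dW' : R} [IsDomain R] (hX : X ≠ 0)
    (hC : W * A = C) (hA : A = X * (r * (1 + 2 * κ * C) + i * A'))
    (hdW : dW = X * (dq - i * dW' + κ * (dr * W ^ 2 + 2 * r * W * dW))) :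
    r * dW + dr * W = A * dq + (W + κ * (W * C)) * dr - i * (A' * dW + A * dW') := by
  apply mul_left_cancel₀ hX
  linear_combination (-dW) * hA + A * hdW + (X * κ * dr * W + 2 * X * κ * r * dW) * hC

/-- The same Green identity, now with source $W$ in the linearized equation; this is the equation
satisfied by $X\partial_XW$. -/
theorem riccati_scaling {A A' dW dW' : R}
    (hC : W * A = C) (hA : A = X * (r * (1 + 2 * κ * C) + i * A'))
    (hdW : dW = W + X * (-i * dW' + 2 * κ * r * W * dW)) :
    X * (r * dW) = C - X * (i * (A' * dW + A * dW')) := by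
  linear_combination (-dW) * hA + A * hdW + (1 + 2 * X * κ * r * dW) * hC

end RiccatiIdentities

/-! ## Gâteaux derivatives -/

section Gateaux

variable {X Y Z : Type*} [AddCommGroup X] [Module ℝ X]
  [AddCommGroup Y] [Module ℝ Y] [TopologicalSpace Y]
  [AddCommGroup Z] [Module ℝ Z] [TopologicalSpace Z]

theorem HasGateauxDeriv.clm_comp {f : X → Y} {x v : X} {y : Y} (h : HasGateauxDeriv f x v y)
    (T : Y →L[ℝ] Z) : HasGateauxDeriv (fun x => T (f x)) x v (T y) := by
  have := (T.continuous.tendsto y).comp h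
  refine this.congr fun t => ?_
  simp

theorem HasGateauxDeriv.add [ContinuousAdd Y] {f g : X → Y} {x v : X} {y z : Y}
    (hf : HasGateauxDeriv f x v y) (hg : HasGateauxDeriv g x v z) :
    HasGateauxDeriv (fun x => f x + g x) x v (y + z) := by
  refine (Tendsto.add hf hg).congr fun t => ?_
  rw [← smul_add, add_sub_add_comm]

theorem HasGateauxDeriv.sum [ContinuousAdd Y] {ι : Type*} (s : Finset ι) {f : ι → X → Y}
    {x v : X} {y : ι → Y} (hf : ∀ i ∈ s, HasGateauxDeriv (f i) x v (y i)) :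
    HasGateauxDeriv (fun x => ∑ i ∈ s, f i x) x v (∑ i ∈ s, y i) := by
  refine (tendsto_finsetSum s hf).congr fun t => ?_
  rw [← Finset.smul_sum, Finset.sum_sub_distrib]

theorem hasGateauxDeriv_const (c : Y) (x v : X) : HasGateauxDeriv (fun _ : X => c) x v 0 := by
  simp only [HasGateauxDeriv, sub_self, smul_zero]
  exact tendsto_const_nhds

theorem hasGateauxDeriv_linear (T : X →ₗ[ℝ] Y) (x v : X) :
    HasGateauxDeriv (fun x => T x) x v (T v) := by
  refine (tendsto_const_nhds (x := T v)).congr' ?_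
  filter_upwards [self_mem_nhdsWithin] with t ht
  rw [map_add, add_sub_cancel_left, map_smul, inv_smul_smul₀ ht]

/-- Continuity along a line is all that the product rule needs, and it follows by multiplying the
difference quotient by $t\to0$. -/
theorem HasGateauxDeriv.tendsto [ContinuousAdd Y] [ContinuousSMul ℝ Y] {f : X → Y} {x v : X}
    {y : Y} (hf : HasGateauxDeriv f x v y) :
    Tendsto (fun t : ℝ => f (x + t • v)) (𝓝[≠] 0) (𝓝 (f x)) := by
  have h0 : Tendsto (fun t : ℝ => t) (𝓝[≠] 0) (𝓝 0) := nhdsWithin_le_nhds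
  have h := (h0.smul hf).const_add (f x)
  rw [zero_smul, add_zero] at h
  refine h.congr' ?_
  filter_upwards [self_mem_nhdsWithin] with t ht
  rw [smul_inv_smul₀ ht, add_sub_cancel]

theorem HasGateauxDeriv.bilinear [ContinuousAdd Y] [ContinuousSMul ℝ Y] [ContinuousAdd Z]
    {f g : X → Y} {x v : X}
    {y z : Y} (B : Y →ₗ[ℝ] Y →ₗ[ℝ] Z) (hB : Continuous fun p : Y × Y => B p.1 p.2)
    (hf : HasGateauxDeriv f x v y) (hg : HasGateauxDeriv g x v z) :
    HasGateauxDeriv (fun x => B (f x) (g x)) x v (B y (g x) + B (f x) z) := by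
  have h1 := (hB.tendsto (y, g x)).comp (Tendsto.prodMk_nhds hf hg.tendsto)
  have h2 := (hB.tendsto (f x, z)).comp (Tendsto.prodMk_nhds tendsto_const_nhds hg)
  refine (h1.add h2).congr fun t => ?_
  simp only [Function.comp, map_sub, map_smul, LinearMap.smul_apply, LinearMap.sub_apply, ← smul_add]
  congr 1
  abel

theorem GateauxSmooth.clm_comp [TopologicalSpace X] {f : X → Y} (h : GateauxSmooth f)
    (T : Y →L[ℝ] Z) : GateauxSmooth fun x => T (f x) := by
  obtain ⟨D, h0, hc, hd⟩ := h
  exact ⟨fun r x v => T (D r x v), fun x v => congrArg T (h0 x v), fun r => T.continuous.comp (hc r),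
    fun r x v u => (hd r x v u).clm_comp T⟩

theorem GateauxSmooth.prodMk [TopologicalSpace X] {f : X → Y} {g : X → Z} (hf : GateauxSmooth f)
    (hg : GateauxSmooth g) : GateauxSmooth fun x => (f x, g x) := by
  obtain ⟨D, h0, hc, hd⟩ := hf
  obtain ⟨D', h0', hc', hd'⟩ := hg
  exact ⟨fun r x v => (D r x v, D' r x v), fun x v => Prod.ext (h0 x v) (h0' x v),
    fun r => (hc r).prodMk (hc' r),
    fun r x v u => Tendsto.prodMk_nhds (hd r x v u) (hd' r x v u)⟩

end Gateaux

/-! ## Polynomial maps -/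

section PolynomialMaps

variable {X Y : Type*} [AddCommGroup X] [Module ℝ X] [TopologicalSpace X]
  [AddCommGroup Y] [Module ℝ Y] [TopologicalSpace Y]

/-- Maps of a point and `r` directions that are built from continuous linear maps by means of
sums and a bilinear product `B`. -/
inductive PolynomialFamily (B : Y →ₗ[ℝ] Y →ₗ[ℝ] Y) (r : ℕ) : (X → (Fin r → X) → Y) → Prop
  | zero : PolynomialFamily B r fun _ _ => 0
  | point (T : X →L[ℝ] Y) : PolynomialFamily B r fun x _ => T x
  | direction (i : Fin r) (T : X →L[ℝ] Y) : PolynomialFamily B r fun _ v => T (v i)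
  | add {F G : X → (Fin r → X) → Y} (hF : PolynomialFamily B r F)
      (hG : PolynomialFamily B r G) : PolynomialFamily B r fun x v => F x v + G x v
  | clm {F : X → (Fin r → X) → Y} (T : Y →L[ℝ] Y) (hF : PolynomialFamily B r F) :
      PolynomialFamily B r fun x v => T (F x v)
  | mul {F G : X → (Fin r → X) → Y} (hF : PolynomialFamily B r F)
      (hG : PolynomialFamily B r G) : PolynomialFamily B r fun x v => B (F x v) (G x v)

namespace PolynomialFamily

variable {B : Y →ₗ[ℝ] Y →ₗ[ℝ] Y}

theorem init {r : ℕ} {F : X → (Fin r → X) → Y} (hF : PolynomialFamily B r F) :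
    PolynomialFamily B (r + 1) fun x v => F x (Fin.init v) := by
  induction hF with
  | zero => exact zero
  | point T => exact point T
  | direction i T => exact direction i.castSucc T
  | add _ _ hF hG => exact hF.add hG
  | clm T _ hF => exact hF.clm T
  | mul _ _ hF hG => exact hF.mul hG

theorem continuous [ContinuousAdd Y] (hB : Continuous fun p : Y × Y => B p.1 p.2) {r : ℕ}
    {F : X → (Fin r → X) → Y} (hF : PolynomialFamily B r F) :
    Continuous fun p : X × (Fin r → X) => F p.1 p.2 := by
  induction hF with
  | zero => exact continuous_const
  | point T => exact T.continuous.comp continuous_fst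
  | direction i T => exact T.continuous.comp ((continuous_apply i).comp continuous_snd)
  | add _ _ hF hG => exact hF.add hG
  | clm T _ hF => exact T.continuous.comp hF
  | mul _ _ hF hG => exact hB.comp (hF.prodMk hG)

/-- The class is closed under differentiation, the new direction becoming the last of $r+1$.
Iteration therefore produces all derivatives, each jointly continuous. -/
theorem exists_deriv [ContinuousAdd Y] [ContinuousSMul ℝ Y]
    (hB : Continuous fun p : Y × Y => B p.1 p.2) {r : ℕ}
    {F : X → (Fin r → X) → Y} (hF : PolynomialFamily B r F) :
    ∃ F', PolynomialFamily B (r + 1) F' ∧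
      ∀ x v u, HasGateauxDeriv (fun y => F y v) x u (F' x (Fin.snoc v u)) := by
  induction hF with
  | zero => exact ⟨_, zero, fun x v u => hasGateauxDeriv_const _ _ _⟩
  | point T =>
    refine ⟨_, direction (Fin.last r) T, fun x v u => ?_⟩
    simpa using hasGateauxDeriv_linear T.toLinearMap x u
  | direction i T => exact ⟨_, zero, fun x v u => hasGateauxDeriv_const _ _ _⟩
  | add _ _ hF hG =>
    obtain ⟨F', hF', hF⟩ := hF
    obtain ⟨G', hG', hG⟩ := hG
    exact ⟨_, hF'.add hG', fun x v u => (hF x v u).add (hG x v u)⟩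
  | clm T _ hF =>
    obtain ⟨F', hF', hF⟩ := hF
    exact ⟨_, hF'.clm T, fun x v u => (hF x v u).clm_comp T⟩
  | mul hF₀ hG₀ hF hG =>
    obtain ⟨F', hF', hF⟩ := hF
    obtain ⟨G', hG', hG⟩ := hG
    refine ⟨_, (hF'.mul hG₀.init).add (hF₀.init.mul hG'), fun x v u => ?_⟩
    simpa only [Fin.init_snoc] using (hF x v u).bilinear B hB (hG x v u)

theorem gateauxSmooth [ContinuousAdd Y] [ContinuousSMul ℝ Y]
    (hB : Continuous fun p : Y × Y => B p.1 p.2) {f : X → Y}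
    (hf : PolynomialFamily B 0 fun x _ => f x) : GateauxSmooth f := by
  -- `N` is defined on all families, with no information on those that are not polynomial; this lets
  -- `D` be defined by plain recursion before polynomiality is proved by induction.
  choose! N hN using fun (r : ℕ) (F : X → (Fin r → X) → Y) (hF : PolynomialFamily B r F) =>
    hF.exists_deriv hB
  let D : (r : ℕ) → X → (Fin r → X) → Y := fun r =>
    Nat.rec (motive := fun r => X → (Fin r → X) → Y) (fun x _ => f x) (fun r F => N r F) r
  have hD : ∀ r, PolynomialFamily B r (D r) := fun r => by
    induction r with
    | zero => exact hf
    | succ r ih => exact (hN r _ ih).1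
  exact ⟨D, fun x v => rfl, fun r => (hD r).continuous hB, fun r => (hN r _ (hD r)).2⟩

theorem sum {r : ℕ} {ι : Type*} (s : Finset ι) {F : ι → X → (Fin r → X) → Y}
    (hF : ∀ i ∈ s, PolynomialFamily B r (F i)) :
    PolynomialFamily B r fun x v => ∑ i ∈ s, F i x v := by
  classical
  induction s using Finset.induction_on with
  | empty => exact zero
  | insert a s ha ih =>
    simp only [Finset.sum_insert ha]
    exact (hF a (Finset.mem_insert_self _ _)).add
      (ih fun i hi => hF i (Finset.mem_insert_of_mem hi))

end PolynomialFamily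

end PolynomialMaps

/-! ## Function spaces closed under products and derivatives -/

/-- The operations on a topological vector space `E` of complex functions on the line that enter
the construction of the hierarchy: a continuous product, derivative, conjugation, multiplication
by complex constants, and integral over `Ω` which vanishes on derivatives. -/
structure SmoothFunctionAlgebra (E : Type*) [FunLike E ℝ ℂ] [AddCommGroup E] [Module ℝ E]
    [TopologicalSpace E] (Ω : Set ℝ) where
  coe_add : ∀ (f g : E) (x : ℝ), (f + g) x = f x + g x
  coe_smul : ∀ (c : ℝ) (f : E) (x : ℝ), (c • f) x = c * f x
  differentiable : ∀ f : E, Differentiable ℝ f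
  mul : E →ₗ[ℝ] E →ₗ[ℝ] E
  mul_apply : ∀ (f g : E) (x : ℝ), mul f g x = f x * g x
  continuous_mul : Continuous fun p : E × E => mul p.1 p.2
  der : E →L[ℝ] E
  der_apply : ∀ (f : E) (x : ℝ), der f x = deriv f x
  star : E →L[ℝ] E
  star_apply : ∀ (f : E) (x : ℝ), star f x = conj (f x)
  const : ℂ → E →L[ℝ] E
  const_apply : ∀ (c : ℂ) (f : E) (x : ℝ), const c f x = c * f x
  integral : E →L[ℝ] ℂ
  integral_apply : ∀ f : E, integral f = ∫ x in Ω, f x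
  integrableOn : ∀ f : E, IntegrableOn f Ω
  integral_der : ∀ f : E, integral (der f) = 0
  omegaV_left_injective : ∀ g h : E × E, (∀ δ : E × E, omegaV Ω g δ = omegaV Ω h δ) → g = h

namespace SmoothFunctionAlgebra

section

variable {E : Type*} [FunLike E ℝ ℂ]

/-- The generating series of the values at `x` of a sequence of functions. -/
def series (a : ℕ → E) (x : ℝ) : PowerSeries ℂ := PowerSeries.mk fun n => a n x

theorem coeff_series (a : ℕ → E) (x : ℝ) (n : ℕ) : PowerSeries.coeff n (series a x) = a n x :=
  PowerSeries.coeff_mk _ _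

end

variable {E : Type*} [FunLike E ℝ ℂ] [AddCommGroup E] [Module ℝ E] [TopologicalSpace E]
  {Ω : Set ℝ} (S : SmoothFunctionAlgebra E Ω)

include S in
theorem coe_zero (x : ℝ) : (0 : E) x = 0 := by
  have h := S.coe_add 0 0 x
  rw [add_zero] at h
  simpa using h

include S in
theorem coe_sum {ι : Type*} (s : Finset ι) (f : ι → E) (x : ℝ) :
    (∑ i ∈ s, f i) x = ∑ i ∈ s, f i x := by
  classical
  induction s using Finset.induction_on with
  | empty => simpa using S.coe_zero x
  | insert a s ha ih => rw [Finset.sum_insert ha, Finset.sum_insert ha, S.coe_add, ih]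

theorem hasDerivAt (f : E) (x : ℝ) : HasDerivAt f (S.der f x) x := by
  rw [S.der_apply]
  exact (S.differentiable f x).hasDerivAt

theorem der_mul (f g : E) : S.der (S.mul f g) = S.mul (S.der f) g + S.mul f (S.der g) := by
  refine DFunLike.ext _ _ fun x => ?_
  rw [S.coe_add, S.mul_apply, S.mul_apply]
  refine (S.hasDerivAt _ x).unique ?_
  have h : ⇑(S.mul f g) = fun x => f x * g x := funext (S.mul_apply f g)
  rw [h]
  exact (S.hasDerivAt f x).mul (S.hasDerivAt g x)

theorem integral_const (c : ℂ) (f : E) : S.integral (S.const c f) = c * S.integral f := by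
  simp only [S.integral_apply, S.const_apply, integral_const_mul]

theorem integral_star (f : E) : S.integral (S.star f) = conj (S.integral f) := by
  simp only [S.integral_apply, S.star_apply, integral_conj]

/-! ### Cauchy products -/

/-- The Cauchy product of two sequences of functions. -/
def conv (a b : ℕ → E) (n : ℕ) : E :=
  ∑ p ∈ Finset.HasAntidiagonal.antidiagonal n, S.mul (a p.1) (b p.2)

theorem series_conv (a b : ℕ → E) (x : ℝ) :
    series (S.conv a b) x = series a x * series b x := by
  ext n
  rw [PowerSeries.coeff_mul, coeff_series, conv, S.coe_sum]
  exact Finset.sum_congr rfl fun p _ => by rw [S.mul_apply, coeff_series, coeff_series]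

theorem der_conv (a b : ℕ → E) (n : ℕ) :
    S.der (S.conv a b n) =
      S.conv (fun k => S.der (a k)) b n + S.conv a (fun k => S.der (b k)) n := by
  simp only [conv, map_sum, S.der_mul, Finset.sum_add_distrib]

theorem series_der_conv (a b : ℕ → E) (x : ℝ) :
    series (fun n => S.der (S.conv a b n)) x =
      series (fun n => S.der (a n)) x * series b x +
        series a x * series (fun n => S.der (b n)) x := by
  rw [← S.series_conv, ← S.series_conv]
  ext n
  rw [map_add, coeff_series, coeff_series, coeff_series, S.der_conv, S.coe_add]

theorem conv_zero {a b : ℕ → E} (ha : a 0 = 0) : S.conv a b 0 = 0 := by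
  simp [conv, ha]

/-! ### The sequences of the hierarchy -/

/-- The coefficients of the formal solution of `W = X (q + c W' + κ r W²)`. -/
def riccati (c : ℂ) (κ : ℝ) (q r : E) : ℕ → E
  | 0 => 0
  | n + 1 => (if n = 0 then q else 0) + S.const c (S.der (riccati c κ q r n)) +
      κ • S.mul r (∑ p ∈ (Finset.HasAntidiagonal.antidiagonal n).attach,
        S.mul (riccati c κ q r p.1.1) (riccati c κ q r p.1.2))
termination_by n => n
decreasing_by
  · omega
  · have := Finset.HasAntidiagonal.mem_antidiagonal.1 p.2; omega
  · have := Finset.HasAntidiagonal.mem_antidiagonal.1 p.2; omega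

theorem riccati_zero (c : ℂ) (κ : ℝ) (q r : E) : S.riccati c κ q r 0 = 0 := by
  rw [riccati]

theorem riccati_succ (c : ℂ) (κ : ℝ) (q r : E) (n : ℕ) :
    S.riccati c κ q r (n + 1) = (if n = 0 then q else 0) +
      S.const c (S.der (S.riccati c κ q r n)) +
        κ • S.mul r (S.conv (S.riccati c κ q r) (S.riccati c κ q r) n) := by
  rw [riccati, conv]
  congr 3
  exact Finset.sum_attach (Finset.HasAntidiagonal.antidiagonal n)
    fun p => S.mul (S.riccati c κ q r p.1) (S.riccati c κ q r p.2)

/-- The coefficients of the linearization of `riccati` at `(q, r)` in direction `(dq, dr)`. -/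
def dRiccati (c : ℂ) (κ : ℝ) (q r dq dr : E) : ℕ → E
  | 0 => 0
  | n + 1 => (if n = 0 then dq else 0) + S.const c (S.der (dRiccati c κ q r dq dr n)) +
      κ • (S.mul dr (S.conv (S.riccati c κ q r) (S.riccati c κ q r) n) +
        S.mul r (∑ p ∈ (Finset.HasAntidiagonal.antidiagonal n).attach,
          (S.mul (dRiccati c κ q r dq dr p.1.1) (S.riccati c κ q r p.1.2) +
            S.mul (S.riccati c κ q r p.1.1) (dRiccati c κ q r dq dr p.1.2))))
termination_by n => n
decreasing_by
  · omega
  · have := Finset.HasAntidiagonal.mem_antidiagonal.1 p.2; omega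
  · have := Finset.HasAntidiagonal.mem_antidiagonal.1 p.2; omega

theorem dRiccati_zero (c : ℂ) (κ : ℝ) (q r dq dr : E) : S.dRiccati c κ q r dq dr 0 = 0 := by
  rw [dRiccati]

theorem dRiccati_succ (c : ℂ) (κ : ℝ) (q r dq dr : E) (n : ℕ) :
    S.dRiccati c κ q r dq dr (n + 1) = (if n = 0 then dq else 0) +
      S.const c (S.der (S.dRiccati c κ q r dq dr n)) +
      κ • (S.mul dr (S.conv (S.riccati c κ q r) (S.riccati c κ q r) n) +
        S.mul r (S.conv (S.dRiccati c κ q r dq dr) (S.riccati c κ q r) n +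
          S.conv (S.riccati c κ q r) (S.dRiccati c κ q r dq dr) n)) := by
  rw [dRiccati, conv, conv, conv, ← Finset.sum_add_distrib]
  congr 4
  exact Finset.sum_attach (Finset.HasAntidiagonal.antidiagonal n)
    fun p => S.mul (S.dRiccati c κ q r dq dr p.1) (S.riccati c κ q r p.2) +
      S.mul (S.riccati c κ q r p.1) (S.dRiccati c κ q r dq dr p.2)

/-- The coefficients of the formal solution of `C = U + κ U C`, where `U` has no constant term. -/
def geom (κ : ℝ) (u : ℕ → E) (n : ℕ) : E :=
  u n + κ • ∑ k : Fin n, S.mul (u (n - k)) (geom κ u k)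
decreasing_by exact k.2

/-- The recursion only sums over $k<n$; the missing term $k=n$ of the Cauchy product carries the
factor $u_0=0$. -/
theorem geom_eq (κ : ℝ) {u : ℕ → E} (hu : u 0 = 0) (n : ℕ) :
    S.geom κ u n = u n + κ • S.conv u (S.geom κ u) n := by
  rw [geom, conv, ← Finset.Nat.sum_antidiagonal_swap, Finset.Nat.sum_antidiagonal_eq_sum_range_succ_mk,
    Finset.sum_range_succ, Fin.sum_univ_eq_sum_range fun k => S.mul (u (n - k)) (S.geom κ u k)]
  simp [hu]

section

variable (κ : ℝ) (q r : E)

/-- The coefficients of the Riccati solution `W`. -/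
def wCoeff : ℕ → E := S.riccati (-Complex.I) κ q r

/-- The coefficients of the adjoint Riccati solution `V`. -/
def vCoeff : ℕ → E := S.riccati Complex.I κ r q

/-- The coefficients of `WV / (1 - κWV)`. -/
def cCoeff : ℕ → E := S.geom κ (S.conv (S.wCoeff κ q r) (S.vCoeff κ q r))

/-- The coefficients of `V / (1 - κWV)`. -/
def aCoeff (n : ℕ) : E :=
  S.vCoeff κ q r n + κ • S.conv (S.vCoeff κ q r) (S.cCoeff κ q r) n

/-- The coefficients of `W / (1 - κWV)`. -/
def bCoeff (n : ℕ) : E :=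
  S.wCoeff κ q r n + κ • S.conv (S.wCoeff κ q r) (S.cCoeff κ q r) n

end

/-! ### Equations for the generating series -/

section

open PowerSeries (X C)

variable (κ : ℝ) (q r : E) (x : ℝ)

theorem series_riccati (c : ℂ) :
    series (S.riccati c κ q r) x = X * (C (q x) +
      C c * series (fun n => S.der (S.riccati c κ q r n)) x +
        C (κ : ℂ) * C (r x) * series (S.riccati c κ q r) x ^ 2) := by
  ext n
  cases n with
  | zero => simp [coeff_series, S.riccati_zero, S.coe_zero]
  | succ n =>
    rw [PowerSeries.coeff_succ_X_mul, sq, ← S.series_conv, mul_assoc]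
    simp only [map_add, PowerSeries.coeff_C_mul, coeff_series, PowerSeries.coeff_C]
    rw [S.riccati_succ, S.coe_add, S.coe_add, S.const_apply, S.coe_smul, S.mul_apply]
    split_ifs
    · rfl
    · rw [S.coe_zero]

theorem series_dRiccati (c : ℂ) (dq dr : E) :
    series (S.dRiccati c κ q r dq dr) x = X * (C (dq x) +
      C c * series (fun n => S.der (S.dRiccati c κ q r dq dr n)) x +
        C (κ : ℂ) * (C (dr x) * series (S.riccati c κ q r) x ^ 2 +
          2 * C (r x) * series (S.riccati c κ q r) x * series (S.dRiccati c κ q r dq dr) x)) := by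
  -- The product is symmetrized to match the two Cauchy products in the recursion of `dRiccati`.
  have h : 2 * C (r x) * series (S.riccati c κ q r) x * series (S.dRiccati c κ q r dq dr) x =
      C (r x) * (series (S.dRiccati c κ q r dq dr) x * series (S.riccati c κ q r) x +
        series (S.riccati c κ q r) x * series (S.dRiccati c κ q r dq dr) x) := by ring
  rw [h]
  ext n
  cases n with
  | zero => simp [coeff_series, S.dRiccati_zero, S.coe_zero]
  | succ n =>
    rw [PowerSeries.coeff_succ_X_mul, sq, ← S.series_conv, ← S.series_conv, ← S.series_conv]
    simp only [map_add, PowerSeries.coeff_C_mul, coeff_series, PowerSeries.coeff_C]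
    rw [S.dRiccati_succ, S.coe_add, S.coe_add, S.const_apply, S.coe_smul, S.coe_add, S.mul_apply,
      S.mul_apply, S.coe_add]
    split_ifs
    · rfl
    · rw [S.coe_zero]

/-- Multiplying the $n$-th coefficient by $n$ is the Euler operator $X\,d/dX$. Applied to the
Riccati equation it linearizes the bracket, while differentiating the prefactor $X$ reproduces the
series itself. -/
theorem series_scaling (c : ℂ) :
    series (fun n => (n : ℝ) • S.riccati c κ q r n) x = series (S.riccati c κ q r) x +
      X * (C c * series (fun n => S.der ((n : ℝ) • S.riccati c κ q r n)) x +
        2 * C (κ : ℂ) * C (r x) * series (S.riccati c κ q r) x *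
          series (fun n => (n : ℝ) • S.riccati c κ q r n) x) := by
  have hd : ∀ a : ℕ → E, series (fun n => (n : ℝ) • a n) x =
      X * PowerSeries.derivative ℂ (series a x) := fun a => by
    ext n
    cases n with
    | zero => simp [coeff_series, S.coe_zero]
    | succ n =>
      rw [PowerSeries.coeff_succ_X_mul, PowerSeries.coeff_derivative, coeff_series, coeff_series,
        S.coe_smul]
      push_cast
      ring
  simp only [map_smul]
  rw [hd, hd]
  have h := S.series_riccati κ q r x c
  have h' := congrArg (PowerSeries.derivative ℂ) h
  simp only [Derivation.leibniz, map_add, smul_eq_mul, PowerSeries.derivative_C, sq,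
    PowerSeries.derivative_X] at h'
  linear_combination (-1 : PowerSeries ℂ) * h + X * h'

theorem series_add_smul_conv (a b c : ℕ → E) :
    series (fun n => a n + κ • S.conv b c n) x =
      series a x + C (κ : ℂ) * (series b x * series c x) := by
  rw [← S.series_conv]
  ext n
  rw [map_add, PowerSeries.coeff_C_mul, coeff_series, coeff_series, coeff_series, S.coe_add,
    S.coe_smul]

theorem series_der_add_smul_conv (a b c : ℕ → E) :
    series (fun n => S.der (a n + κ • S.conv b c n)) x =
      series (fun n => S.der (a n)) x + C (κ : ℂ) *
        (series (fun n => S.der (b n)) x * series c x +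
          series b x * series (fun n => S.der (c n)) x) := by
  rw [← S.series_der_conv]
  ext n
  rw [map_add, PowerSeries.coeff_C_mul, coeff_series, coeff_series, coeff_series, map_add,
    map_smul, S.coe_add, S.coe_smul]

theorem cCoeff_eq : S.cCoeff κ q r = fun n =>
    S.conv (S.wCoeff κ q r) (S.vCoeff κ q r) n +
      κ • S.conv (S.conv (S.wCoeff κ q r) (S.vCoeff κ q r)) (S.cCoeff κ q r) n :=
  funext fun n => S.geom_eq κ (S.conv_zero (S.riccati_zero _ _ _ _)) n

theorem series_wCoeff :
    series (S.wCoeff κ q r) x = X * (C (q x) -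
      C Complex.I * series (fun n => S.der (S.wCoeff κ q r n)) x +
        C (κ : ℂ) * C (r x) * series (S.wCoeff κ q r) x ^ 2) := by
  have h := S.series_riccati κ q r x (-Complex.I)
  rwa [map_neg, neg_mul, ← sub_eq_add_neg] at h

theorem series_vCoeff :
    series (S.vCoeff κ q r) x = X * (C (r x) +
      C Complex.I * series (fun n => S.der (S.vCoeff κ q r n)) x +
        C (κ : ℂ) * C (q x) * series (S.vCoeff κ q r) x ^ 2) :=
  S.series_riccati κ r q x Complex.I

theorem series_cCoeff :
    series (S.cCoeff κ q r) x = series (S.wCoeff κ q r) x * series (S.vCoeff κ q r) x +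
      C (κ : ℂ) * (series (S.wCoeff κ q r) x * series (S.vCoeff κ q r) x *
        series (S.cCoeff κ q r) x) := by
  conv_lhs => rw [cCoeff_eq]
  rw [S.series_add_smul_conv, S.series_conv]

theorem series_der_cCoeff :
    series (fun n => S.der (S.cCoeff κ q r n)) x =
      series (fun n => S.der (S.wCoeff κ q r n)) x * series (S.vCoeff κ q r) x +
      series (S.wCoeff κ q r) x * series (fun n => S.der (S.vCoeff κ q r n)) x +
      C (κ : ℂ) * ((series (fun n => S.der (S.wCoeff κ q r n)) x * series (S.vCoeff κ q r) x +
        series (S.wCoeff κ q r) x * series (fun n => S.der (S.vCoeff κ q r n)) x) *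
          series (S.cCoeff κ q r) x +
        series (S.wCoeff κ q r) x * series (S.vCoeff κ q r) x *
          series (fun n => S.der (S.cCoeff κ q r n)) x) := by
  conv_lhs => rw [cCoeff_eq]
  rw [S.series_der_add_smul_conv, S.series_der_conv, S.series_conv]

theorem series_aCoeff :
    series (S.aCoeff κ q r) x = series (S.vCoeff κ q r) x +
      C (κ : ℂ) * (series (S.vCoeff κ q r) x * series (S.cCoeff κ q r) x) :=
  S.series_add_smul_conv κ x _ _ _

theorem series_bCoeff :
    series (S.bCoeff κ q r) x = series (S.wCoeff κ q r) x +
      C (κ : ℂ) * (series (S.wCoeff κ q r) x * series (S.cCoeff κ q r) x) :=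
  S.series_add_smul_conv κ x _ _ _

theorem C_I_mul_C_I : C Complex.I * C Complex.I = (-1 : PowerSeries ℂ) := by
  rw [← map_mul, Complex.I_mul_I, map_neg, map_one]

theorem series_wCoeff_mul_aCoeff :
    series (S.wCoeff κ q r) x * series (S.aCoeff κ q r) x = series (S.cCoeff κ q r) x := by
  rw [series_aCoeff]
  linear_combination -S.series_cCoeff κ q r x

theorem series_vCoeff_mul_bCoeff :
    series (S.vCoeff κ q r) x * series (S.bCoeff κ q r) x = series (S.cCoeff κ q r) x := by
  rw [series_bCoeff]
  linear_combination -S.series_cCoeff κ q r x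

theorem series_der_cCoeff_eq :
    series (fun n => S.der (S.cCoeff κ q r n)) x = -C Complex.I *
      (C (q x) * series (S.aCoeff κ q r) x - C (r x) * series (S.bCoeff κ q r) x) := by
  rw [series_aCoeff, series_bCoeff]
  exact riccati_deriv_product PowerSeries.X_ne_zero C_I_mul_C_I (S.series_wCoeff κ q r x)
    (S.series_vCoeff κ q r x) (S.series_cCoeff κ q r x) (S.series_der_cCoeff κ q r x)

theorem series_aCoeff_eq :
    series (S.aCoeff κ q r) x = X * (C (r x) * (1 + 2 * C (κ : ℂ) * series (S.cCoeff κ q r) x) +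
      C Complex.I * series (fun n => S.der (S.aCoeff κ q r n)) x) := by
  rw [series_aCoeff]
  simp only [aCoeff]
  rw [S.series_der_add_smul_conv]
  exact riccati_adjoint PowerSeries.X_ne_zero C_I_mul_C_I (S.series_wCoeff κ q r x)
    (S.series_vCoeff κ q r x) (S.series_cCoeff κ q r x) (S.series_der_cCoeff κ q r x)

theorem series_bCoeff_eq :
    series (S.bCoeff κ q r) x = X * (C (q x) * (1 + 2 * C (κ : ℂ) * series (S.cCoeff κ q r) x) -
      C Complex.I * series (fun n => S.der (S.bCoeff κ q r n)) x) := by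
  rw [series_bCoeff]
  simp only [bCoeff]
  rw [S.series_der_add_smul_conv, sub_eq_add_neg, ← neg_mul]
  -- The system is invariant under $i\mapsto-i$, $q\leftrightarrow r$, $W\leftrightarrow V$, with
  -- $C$ fixed.
  refine riccati_adjoint (i := -C Complex.I) (V := series (S.wCoeff κ q r) x)
    (V' := series (fun n => S.der (S.wCoeff κ q r n)) x) (W := series (S.vCoeff κ q r) x)
    (W' := series (fun n => S.der (S.vCoeff κ q r n)) x) (q := C (r x))
    PowerSeries.X_ne_zero (by rw [neg_mul_neg, C_I_mul_C_I]) ?_ ?_ ?_ ?_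
  · linear_combination S.series_vCoeff κ q r x
  · linear_combination S.series_wCoeff κ q r x
  · linear_combination S.series_cCoeff κ q r x
  · linear_combination S.series_der_cCoeff κ q r x

end

/-! ### Integral identities -/

section

open PowerSeries (X C)

variable (κ : ℝ) (q r : E)

theorem wCoeff_zero : S.wCoeff κ q r 0 = 0 := S.riccati_zero _ _ _ _

theorem vCoeff_zero : S.vCoeff κ q r 0 = 0 := S.riccati_zero _ _ _ _

theorem aCoeff_zero : S.aCoeff κ q r 0 = 0 := by
  rw [aCoeff, S.conv_zero (S.vCoeff_zero κ q r), vCoeff_zero, smul_zero, add_zero]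

theorem bCoeff_zero : S.bCoeff κ q r 0 = 0 := by
  rw [bCoeff, S.conv_zero (S.wCoeff_zero κ q r), wCoeff_zero, smul_zero, add_zero]

theorem aCoeff_succ (n : ℕ) (x : ℝ) :
    S.aCoeff κ q r (n + 1) x = r x * ((if n = 0 then 1 else 0) + 2 * κ * S.cCoeff κ q r n x) +
      Complex.I * S.der (S.aCoeff κ q r n) x := by
  have h := congrArg (PowerSeries.coeff (n + 1)) (S.series_aCoeff_eq κ q r x)
  have h2 : (2 : PowerSeries ℂ) * C (κ : ℂ) = C (2 * κ : ℂ) := by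
    rw [map_mul, map_ofNat]
  rwa [PowerSeries.coeff_succ_X_mul, h2, map_add, PowerSeries.coeff_C_mul, PowerSeries.coeff_C_mul,
    map_add, PowerSeries.coeff_C_mul, coeff_series, coeff_series, coeff_series,
    PowerSeries.coeff_one] at h

theorem bCoeff_succ (n : ℕ) (x : ℝ) :
    S.bCoeff κ q r (n + 1) x = q x * ((if n = 0 then 1 else 0) + 2 * κ * S.cCoeff κ q r n x) -
      Complex.I * S.der (S.bCoeff κ q r n) x := by
  have h := congrArg (PowerSeries.coeff (n + 1)) (S.series_bCoeff_eq κ q r x)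
  have h2 : (2 : PowerSeries ℂ) * C (κ : ℂ) = C (2 * κ : ℂ) := by
    rw [map_mul, map_ofNat]
  rwa [PowerSeries.coeff_succ_X_mul, h2, map_sub, PowerSeries.coeff_C_mul, PowerSeries.coeff_C_mul,
    map_add, PowerSeries.coeff_C_mul, coeff_series, coeff_series, coeff_series,
    PowerSeries.coeff_one] at h

theorem der_cCoeff (n : ℕ) (x : ℝ) :
    S.der (S.cCoeff κ q r n) x =
      -Complex.I * (q x * S.aCoeff κ q r n x - r x * S.bCoeff κ q r n x) := by
  have h := congrArg (PowerSeries.coeff n) (S.series_der_cCoeff_eq κ q r x)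
  rwa [← map_neg, PowerSeries.coeff_C_mul, map_sub, PowerSeries.coeff_C_mul,
    PowerSeries.coeff_C_mul, coeff_series, coeff_series, coeff_series] at h

/-- Identifies $a_n$ and $b_n$ as the variational derivatives of $\int r w_n$ with respect to $q$
and $r$: both sides differ by the derivative of the $n$-th coefficient of $-iA\,dW$. -/
theorem integral_variation (dq dr : E) (n : ℕ) :
    S.integral (S.mul dr (S.wCoeff κ q r n) +
      S.mul r (S.dRiccati (-Complex.I) κ q r dq dr n)) =
    S.integral (S.mul (S.aCoeff κ q r n) dq + S.mul (S.bCoeff κ q r n) dr) := by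
  set dw := S.dRiccati (-Complex.I) κ q r dq dr with hdw
  have key : S.mul dr (S.wCoeff κ q r n) + S.mul r (dw n) =
      S.mul (S.aCoeff κ q r n) dq + S.mul (S.bCoeff κ q r n) dr +
        S.const (-Complex.I) (S.der (S.conv (S.aCoeff κ q r) dw n)) := by
    refine DFunLike.ext _ _ fun x => ?_
    have h := S.series_dRiccati κ q r x (-Complex.I) dq dr
    rw [map_neg, neg_mul, ← sub_eq_add_neg] at h
    have h1 := riccati_variation PowerSeries.X_ne_zero (S.series_wCoeff_mul_aCoeff κ q r x)
      (S.series_aCoeff_eq κ q r x) h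
    rw [← hdw, ← series_bCoeff, ← S.series_der_conv] at h1
    have h2 := congrArg (PowerSeries.coeff n) h1
    simp only [map_add, map_sub, PowerSeries.coeff_C_mul, PowerSeries.coeff_mul_C,
      coeff_series] at h2
    simp only [S.coe_add, S.mul_apply, S.const_apply]
    linear_combination h2
  rw [key, map_add, integral_const, S.integral_der, mul_zero, add_zero]

theorem integral_mul_wCoeff (n : ℕ) :
    n * S.integral (S.mul r (S.wCoeff κ q r n)) = S.integral (S.cCoeff κ q r (n + 1)) := by
  set dw : ℕ → E := fun n => (n : ℝ) • S.wCoeff κ q r n with hdw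
  have key : (n : ℝ) • S.mul r (S.wCoeff κ q r n) = S.cCoeff κ q r (n + 1) +
        S.const (-Complex.I) (S.der (S.conv (S.aCoeff κ q r) dw n)) := by
    refine DFunLike.ext _ _ fun x => ?_
    have h1 := riccati_scaling (i := C Complex.I) (κ := C (κ : ℂ)) (r := C (r x))
      (dW := series dw x) (dW' := series (fun n => S.der (dw n)) x)
      (S.series_wCoeff_mul_aCoeff κ q r x) (S.series_aCoeff_eq κ q r x)
      (by have h := S.series_scaling κ q r x (-Complex.I)
          rwa [map_neg] at h)
    rw [← S.series_der_conv] at h1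
    -- The prefactor $X$ in the scaling identity is the reason why $w_n$ is matched with $c_{n+1}$.
    have h2 := congrArg (PowerSeries.coeff (n + 1)) h1
    simp only [map_sub, PowerSeries.coeff_C_mul, PowerSeries.coeff_succ_X_mul, coeff_series] at h2
    simp only [hdw, S.coe_add, S.mul_apply, S.const_apply, S.coe_smul] at h2 ⊢
    linear_combination h2
  have h := congrArg S.integral key
  rw [map_smul, map_add, integral_const, S.integral_der, mul_zero, add_zero] at h
  rw [← h, Complex.real_smul, Complex.ofReal_natCast]

theorem integral_mul_vCoeff (n : ℕ) :
    n * S.integral (S.mul q (S.vCoeff κ q r n)) = S.integral (S.cCoeff κ q r (n + 1)) := by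
  set dv : ℕ → E := fun n => (n : ℝ) • S.vCoeff κ q r n with hdv
  have key : (n : ℝ) • S.mul q (S.vCoeff κ q r n) = S.cCoeff κ q r (n + 1) +
        S.const Complex.I (S.der (S.conv (S.bCoeff κ q r) dv n)) := by
    refine DFunLike.ext _ _ fun x => ?_
    have h1 := riccati_scaling (i := -C Complex.I) (κ := C (κ : ℂ)) (r := C (q x))
      (dW := series dv x) (dW' := series (fun n => S.der (dv n)) x)
      (S.series_vCoeff_mul_bCoeff κ q r x)
      (by have h := S.series_bCoeff_eq κ q r x
          rwa [sub_eq_add_neg, ← neg_mul] at h)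
      (by have h := S.series_scaling κ r q x Complex.I
          rwa [neg_neg])
    rw [← S.series_der_conv, neg_mul, mul_neg, sub_neg_eq_add] at h1
    have h2 := congrArg (PowerSeries.coeff (n + 1)) h1
    simp only [map_add, PowerSeries.coeff_C_mul, PowerSeries.coeff_succ_X_mul, coeff_series] at h2
    simp only [hdv, S.coe_add, S.mul_apply, S.const_apply, S.coe_smul] at h2 ⊢
    linear_combination h2
  have h := congrArg S.integral key
  rw [map_smul, map_add, integral_const, S.integral_der, mul_zero, add_zero] at h
  rw [← h, Complex.real_smul, Complex.ofReal_natCast]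

/-- This symmetry between $W$ and $V$ is what makes $I_{b,n}$ real: both integrals are $\frac1n\int
c_{n+1}$. -/
theorem integral_mul_wCoeff_eq_integral_mul_vCoeff {n : ℕ} (hn : 1 ≤ n) :
    S.integral (S.mul r (S.wCoeff κ q r n)) = S.integral (S.mul q (S.vCoeff κ q r n)) := by
  have hn' : (n : ℂ) ≠ 0 := Nat.cast_ne_zero.2 (by omega)
  exact mul_left_cancel₀ hn' ((S.integral_mul_wCoeff κ q r n).trans
    (S.integral_mul_vCoeff κ q r n).symm)

theorem integral_commutator_succ (n m : ℕ) :
    S.integral (S.mul (S.aCoeff κ q r (n + 1)) (S.bCoeff κ q r m) -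
      S.mul (S.bCoeff κ q r (n + 1)) (S.aCoeff κ q r m)) =
    S.integral (S.mul (S.aCoeff κ q r n) (S.bCoeff κ q r (m + 1)) -
      S.mul (S.bCoeff κ q r n) (S.aCoeff κ q r (m + 1))) := by
  set a := S.aCoeff κ q r with ha
  set b := S.bCoeff κ q r with hb
  set c := S.cCoeff κ q r with hc
  have hsub : ∀ (f g : E) (x : ℝ), (f - g) x = f x - g x := fun f g x => by
    rw [eq_sub_iff_add_eq, ← S.coe_add, sub_add_cancel]
  -- The terms $ia_n'$, $-ib_n'$ of the recursions, and those with index $m$, assemble into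
  -- $i(a_nb_m+b_na_m)'$. In the remaining ones $qa_k-rb_k=ic_k'$ for $k=n,m$, which gives the terms
  -- in $c$. The indicators of $n=0$ and $m=0$ are the coefficients of the constant 1 in $1+2\kappa
  -- C$.
  have key : S.mul (a (n + 1)) (b m) - S.mul (b (n + 1)) (a m) =
      (S.mul (a n) (b (m + 1)) - S.mul (b n) (a (m + 1))) + S.const Complex.I (S.der
        (S.mul (a n) (b m) + S.mul (b n) (a m) - (if n = 0 then (1 : ℝ) else 0) • c m -
          (if m = 0 then (1 : ℝ) else 0) • c n - (2 * κ) • S.mul (c n) (c m))) := by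
    refine DFunLike.ext _ _ fun x => ?_
    simp only [map_add, map_sub, map_smul, S.der_mul, hsub, S.coe_add, S.coe_smul, S.const_apply,
      S.mul_apply]
    simp only [ha, hb, hc, S.aCoeff_succ, S.bCoeff_succ, S.der_cCoeff]
    simp only [apply_ite Complex.ofReal, Complex.ofReal_one, Complex.ofReal_zero,
      Complex.ofReal_mul, Complex.ofReal_ofNat]
    generalize (if n = 0 then (1 : ℂ) else 0) = εn
    generalize (if m = 0 then (1 : ℂ) else 0) = εm
    linear_combination (-(εn + 2 * κ * S.cCoeff κ q r n x) *
      (q x * S.aCoeff κ q r m x - r x * S.bCoeff κ q r m x) -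
      (εm + 2 * κ * S.cCoeff κ q r m x) *
      (q x * S.aCoeff κ q r n x - r x * S.bCoeff κ q r n x)) * Complex.I_mul_I
  rw [key, map_add, integral_const, S.integral_der, mul_zero, add_zero]

theorem integral_commutator (n m : ℕ) :
    S.integral (S.mul (S.aCoeff κ q r n) (S.bCoeff κ q r m)) =
      S.integral (S.mul (S.bCoeff κ q r n) (S.aCoeff κ q r m)) := by
  rw [← sub_eq_zero, ← map_sub]
  -- Each step lowers $n$ and raises $m$, so $m$ has to be free; at $n=0$ the coefficients
  -- $a_0=b_0=0$ end the descent.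
  induction n generalizing m with
  | zero => simp [aCoeff_zero, bCoeff_zero]
  | succ n ih => rw [integral_commutator_succ, ih]

end

/-! ### Dependence on the functions `q` and `r` -/

section

variable {X : Type*} [AddCommGroup X] [Module ℝ X]

theorem hasGateauxDeriv_mul [ContinuousAdd E] [ContinuousSMul ℝ E] {f g : X → E} {x v : X}
    {y z : E} (hf : HasGateauxDeriv f x v y) (hg : HasGateauxDeriv g x v z) :
    HasGateauxDeriv (fun x => S.mul (f x) (g x)) x v (S.mul y (g x) + S.mul (f x) z) :=
  hf.bilinear S.mul S.continuous_mul hg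

theorem hasGateauxDeriv_conv [ContinuousAdd E] [ContinuousSMul ℝ E] {a b : X → ℕ → E} {x v : X}
    {a' b' : ℕ → E} {n : ℕ} (ha : ∀ k ≤ n, HasGateauxDeriv (fun y => a y k) x v (a' k))
    (hb : ∀ k ≤ n, HasGateauxDeriv (fun y => b y k) x v (b' k)) :
    HasGateauxDeriv (fun y => S.conv (a y) (b y) n) x v
      (S.conv a' (b x) n + S.conv (a x) b' n) := by
  simp only [conv]
  rw [← Finset.sum_add_distrib]
  refine HasGateauxDeriv.sum _ fun p hp => ?_
  have hp := Finset.HasAntidiagonal.mem_antidiagonal.1 hp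
  exact S.hasGateauxDeriv_mul (ha _ (by omega)) (hb _ (by omega))

theorem hasGateauxDeriv_riccati [ContinuousAdd E] [ContinuousSMul ℝ E] (c : ℂ) (κ : ℝ)
    {q r : X → E} {x v : X} {dq dr : E}
    (hq : HasGateauxDeriv q x v dq) (hr : HasGateauxDeriv r x v dr) (n : ℕ) :
    HasGateauxDeriv (fun y => S.riccati c κ (q y) (r y) n) x v
      (S.dRiccati c κ (q x) (r x) dq dr n) := by
  induction n using Nat.strong_induction_on with
  | _ n ih =>
    cases n with
    | zero =>
      simp only [riccati_zero, dRiccati_zero]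
      exact hasGateauxDeriv_const _ _ _
    | succ n =>
      simp only [riccati_succ, dRiccati_succ]
      have ih' : ∀ k ≤ n, _ := fun k hk => ih k (Nat.lt_succ_of_le hk)
      refine (HasGateauxDeriv.add ?_ (((ih' n le_rfl).clm_comp S.der).clm_comp (S.const c))).add
        ((S.hasGateauxDeriv_mul hr (S.hasGateauxDeriv_conv ih' ih')).clm_comp
          (κ • ContinuousLinearMap.id ℝ E))
      split_ifs
      · exact hq
      · exact hasGateauxDeriv_const _ _ _

end

section

variable {X : Type*} [AddCommGroup X] [Module ℝ X] [TopologicalSpace X]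

theorem polynomialFamily_conv {a b : X → ℕ → E} {n : ℕ}
    (ha : ∀ k ≤ n, PolynomialFamily S.mul 0 fun y _ => a y k)
    (hb : ∀ k ≤ n, PolynomialFamily S.mul 0 fun y _ => b y k) :
    PolynomialFamily S.mul 0 fun y _ => S.conv (a y) (b y) n := by
  refine PolynomialFamily.sum _ fun p hp => ?_
  have hp := Finset.HasAntidiagonal.mem_antidiagonal.1 hp
  exact (ha _ (by omega)).mul (hb _ (by omega))

variable [ContinuousSMul ℝ E] (κ : ℝ) {q r : X → E}
  (hq : PolynomialFamily S.mul 0 fun y _ => q y) (hr : PolynomialFamily S.mul 0 fun y _ => r y)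

include hq hr

theorem polynomialFamily_riccati (c : ℂ) (n : ℕ) :
    PolynomialFamily S.mul 0 fun y _ => S.riccati c κ (q y) (r y) n := by
  induction n using Nat.strong_induction_on with
  | _ n ih =>
    cases n with
    | zero =>
      simp only [riccati_zero]
      exact .zero
    | succ n =>
      simp only [riccati_succ]
      have ih' : ∀ k ≤ n, _ := fun k hk => ih k (Nat.lt_succ_of_le hk)
      refine (PolynomialFamily.add ?_ (((ih' n le_rfl).clm S.der).clm (S.const c))).add
        ((hr.mul (S.polynomialFamily_conv ih' ih')).clm (κ • ContinuousLinearMap.id ℝ E))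
      split_ifs
      · exact hq
      · exact .zero

theorem polynomialFamily_cCoeff (n : ℕ) :
    PolynomialFamily S.mul 0 fun y _ => S.cCoeff κ (q y) (r y) n := by
  have hu : ∀ k, PolynomialFamily S.mul 0 fun y _ =>
      S.conv (S.wCoeff κ (q y) (r y)) (S.vCoeff κ (q y) (r y)) k := fun k =>
    S.polynomialFamily_conv (fun k _ => S.polynomialFamily_riccati κ hq hr _ k)
      (fun k _ => S.polynomialFamily_riccati κ hr hq _ k)
  induction n using Nat.strong_induction_on with
  | _ n ih =>
    simp only [cCoeff] at ih ⊢
    simp only [geom.eq_def S κ _ n]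
    have hk : ∀ k : Fin n, PolynomialFamily S.mul 0 fun y _ =>
        S.mul (S.conv (S.wCoeff κ (q y) (r y)) (S.vCoeff κ (q y) (r y)) (n - k))
          (S.geom κ (S.conv (S.wCoeff κ (q y) (r y)) (S.vCoeff κ (q y) (r y))) k) := fun k =>
      (hu _).mul (ih k k.2)
    exact (hu n).add ((PolynomialFamily.sum Finset.univ fun k _ => hk k).clm
      (κ • ContinuousLinearMap.id ℝ E))

theorem polynomialFamily_aCoeff (n : ℕ) :
    PolynomialFamily S.mul 0 fun y _ => S.aCoeff κ (q y) (r y) n :=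
  (S.polynomialFamily_riccati κ hr hq _ n).add
    ((S.polynomialFamily_conv (fun k _ => S.polynomialFamily_riccati κ hr hq _ k)
      (fun k _ => S.polynomialFamily_cCoeff κ hq hr k)).clm (κ • ContinuousLinearMap.id ℝ E))

theorem polynomialFamily_bCoeff (n : ℕ) :
    PolynomialFamily S.mul 0 fun y _ => S.bCoeff κ (q y) (r y) n :=
  (S.polynomialFamily_riccati κ hq hr _ n).add
    ((S.polynomialFamily_conv (fun k _ => S.polynomialFamily_riccati κ hq hr _ k)
      (fun k _ => S.polynomialFamily_cCoeff κ hq hr k)).clm (κ • ContinuousLinearMap.id ℝ E))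

end

/-! ### The functionals -/

theorem wSeq_eq_wCoeff (κ : ℝ) (q r : E) (n : ℕ) : wSeq κ q r n = S.wCoeff κ q r n := by
  induction n using Nat.strong_induction_on with
  | _ n ih =>
    match n with
    | 0 =>
      funext x
      rw [wCoeff_zero, S.coe_zero, wSeq]
    | 1 =>
      funext x
      rw [wSeq_one, wCoeff, riccati_succ, riccati_zero, S.conv_zero (S.riccati_zero _ _ _ _)]
      simp
    | n + 2 =>
      funext x
      -- The Cauchy product at $n+1$ has $n+2$ terms; the first and the last contain the zeroth
      -- coefficient, which is 0, and the other $n$ form the sum in `wSeq` after a shift by one.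
      rw [wSeq, ih (n + 1) (by omega), wCoeff,
        S.riccati_succ _ κ q r (n + 1), if_neg (Nat.succ_ne_zero n), zero_add,
        S.coe_add, S.const_apply, S.der_apply, S.coe_smul, S.mul_apply, conv,
        Finset.Nat.sum_antidiagonal_eq_sum_range_succ_mk, Finset.sum_range_succ,
        Finset.sum_range_succ', S.coe_add, S.coe_add, S.coe_sum, Nat.sub_self, riccati_zero,
        map_zero, LinearMap.zero_apply, map_zero, S.coe_zero, add_zero, add_zero]
      beta_reduce
      rw [mul_assoc, Fin.sum_univ_eq_sum_range fun k => wSeq κ q r (k + 1) x * wSeq κ q r (n - k) x]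
      refine congrArg₂ _ rfl (congrArg _ (congrArg _ (Finset.sum_congr rfl fun k hk => ?_)))
      have hk := Finset.mem_range.1 hk
      rw [ih (k + 1) (by omega), ih (n - k) (by omega), S.mul_apply, Nat.add_sub_add_right, wCoeff]

/-! ### Complex conjugation and real-valuedness -/

theorem star_mul (f g : E) : S.star (S.mul f g) = S.mul (S.star f) (S.star g) :=
  DFunLike.ext _ _ fun x => by simp only [S.star_apply, S.mul_apply, map_mul]

theorem star_star (f : E) : S.star (S.star f) = f :=
  DFunLike.ext _ _ fun x => by simp only [S.star_apply, Complex.conj_conj]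

theorem star_der (f : E) : S.star (S.der f) = S.der (S.star f) := by
  refine DFunLike.ext _ _ fun x => ?_
  refine HasDerivAt.unique ?_ (S.hasDerivAt (S.star f) x)
  rw [S.star_apply, show ⇑(S.star f) = fun x => conj (f x) from funext (S.star_apply f)]
  exact (S.hasDerivAt f x).star

theorem star_const (c : ℂ) (f : E) : S.star (S.const c f) = S.const (conj c) (S.star f) :=
  DFunLike.ext _ _ fun x => by simp only [S.star_apply, S.const_apply, map_mul]

/-- As $\kappa$ is real, conjugation only affects $c$ and the data; for $c=\mp i$ it exchanges the
equations of $W$ and $V$. -/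
theorem star_riccati (c : ℂ) (κ : ℝ) (q r : E) (n : ℕ) :
    S.star (S.riccati c κ q r n) = S.riccati (conj c) κ (S.star q) (S.star r) n := by
  induction n using Nat.strong_induction_on with
  | _ n ih =>
    cases n with
    | zero => rw [riccati_zero, riccati_zero, map_zero]
    | succ n =>
      rw [riccati_succ, riccati_succ, map_add, map_add, apply_ite S.star, map_zero, star_const,
        star_der, ih n (by omega), map_smul, star_mul, conv, conv, map_sum]
      refine congrArg _ (congrArg _ (congrArg _ (Finset.sum_congr rfl fun p hp => ?_)))
      have hp := Finset.HasAntidiagonal.mem_antidiagonal.1 hp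
      rw [star_mul, ih _ (by omega), ih _ (by omega)]

theorem itilde_eq (κ : ℝ) (n : ℕ) (f g : E) :
    Itilde Ω κ n f (fun x => conj (g x)) =
      S.integral (S.mul (S.star g) (S.wCoeff κ f (S.star g) n)) := by
  rw [show (fun x => conj (g x)) = ⇑(S.star g) from (funext (S.star_apply g)).symm, Itilde,
    S.wSeq_eq_wCoeff, S.integral_apply]
  simp only [S.mul_apply]

include S in
theorem itilde_conj (κ : ℝ) {n : ℕ} (hn : 1 ≤ n) (f g : E) :
    Itilde Ω κ n g (fun x => conj (f x)) = conj (Itilde Ω κ n f (fun x => conj (g x))) := by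
  rw [S.itilde_eq, S.itilde_eq, S.integral_mul_wCoeff_eq_integral_mul_vCoeff κ f (S.star g) hn,
    ← integral_star, star_mul, vCoeff, star_riccati, star_star, Complex.conj_I, wCoeff]

theorem ibComplex_eq (κ : ℝ) {n : ℕ} (hn : 1 ≤ n) (γ : E × E) :
    IbComplex Ω κ n γ =
      ((S.integral (S.mul (S.star γ.2) (S.wCoeff κ γ.1 (S.star γ.2) n))).re : ℂ) := by
  rw [IbComplex, S.itilde_conj κ hn γ.1 γ.2, S.itilde_eq, Complex.add_conj]
  push_cast
  ring

theorem ib_eq (κ : ℝ) {n : ℕ} (hn : 1 ≤ n) (γ : E × E) :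
    Ib Ω κ n γ = (S.integral (S.mul (S.star γ.2) (S.wCoeff κ γ.1 (S.star γ.2) n))).re := by
  rw [Ib, S.ibComplex_eq κ hn, Complex.ofReal_re]

/-! ### Symplectic gradients and the Poisson bracket -/

theorem omegaV_eq_im_integral (γ δ : E × E) :
    omegaV Ω γ δ = (S.integral (S.mul (S.star γ.1) δ.2 + S.mul (S.star γ.2) δ.1)).im := by
  rw [omegaV_eq, S.integral_apply]
  have h := integral_im (S.integrableOn (S.mul (S.star γ.1) δ.2 + S.mul (S.star γ.2) δ.1))
  simp only [S.coe_add, S.mul_apply, S.star_apply] at h ⊢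
  exact h

/-- The symplectic gradient of `I_{b,n}`. -/
def gradIb (κ : ℝ) (n : ℕ) (γ : E × E) : E × E :=
  (S.const (-Complex.I) (S.bCoeff κ γ.1 (S.star γ.2) n),
    S.const (-Complex.I) (S.star (S.aCoeff κ γ.1 (S.star γ.2) n)))

/-- The factors $-i$ in the gradient turn the imaginary part in $\omega$ into a real part. The
$b$-term appears conjugated, which does not change its real part. -/
theorem omegaV_gradIb (κ : ℝ) (n : ℕ) (γ δ : E × E) :
    omegaV Ω (S.gradIb κ n γ) δ =
      (S.integral (S.mul (S.aCoeff κ γ.1 (S.star γ.2) n) δ.1 +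
        S.mul (S.bCoeff κ γ.1 (S.star γ.2) n) (S.star δ.2))).re := by
  set a := S.aCoeff κ γ.1 (S.star γ.2) n
  set b := S.bCoeff κ γ.1 (S.star γ.2) n
  have h1 : S.mul (S.star (S.const (-Complex.I) b)) δ.2 =
      S.const Complex.I (S.star (S.mul b (S.star δ.2))) := DFunLike.ext _ _ fun x => by
    simp only [S.mul_apply, S.star_apply, S.const_apply, map_mul, map_neg, Complex.conj_I,
      neg_neg, Complex.conj_conj, mul_assoc]
  have h2 : S.mul (S.star (S.const (-Complex.I) (S.star a))) δ.1 =
      S.const Complex.I (S.mul a δ.1) := DFunLike.ext _ _ fun x => by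
    simp only [S.mul_apply, S.star_apply, S.const_apply, map_mul, map_neg, Complex.conj_I,
      neg_neg, Complex.conj_conj, mul_assoc]
  rw [omegaV_eq_im_integral, gradIb, h1, h2, map_add, map_add, integral_const, integral_const,
    integral_star]
  simp [add_comm]

variable [ContinuousAdd E] [ContinuousSMul ℝ E]

theorem isSympGradAt_ib (κ : ℝ) {n : ℕ} (hn : 1 ≤ n) (γ : E × E) :
    IsSympGradAt Ω (Ib Ω κ n) γ (S.gradIb κ n γ) := by
  intro δ
  have hq := hasGateauxDeriv_linear (LinearMap.fst ℝ E E) γ δ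
  have hr := hasGateauxDeriv_linear (S.star.toLinearMap ∘ₗ LinearMap.snd ℝ E E) γ δ
  have h := ((S.hasGateauxDeriv_mul hr (S.hasGateauxDeriv_riccati (-Complex.I) κ hq hr n)).clm_comp
    S.integral).clm_comp Complex.reCLM
  have h' := S.integral_variation κ γ.1 (S.star γ.2) δ.1 (S.star δ.2) n
  rw [omegaV_gradIb, ← h', show Ib Ω κ n = _ from funext fun γ => S.ib_eq κ hn γ]
  exact h

/-- `sympGrad` is an arbitrary choice; nondegeneracy of $\omega$ forces it to be the explicit
gradient. -/
theorem sympGrad_ib (κ : ℝ) {n : ℕ} (hn : 1 ≤ n) :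
    sympGrad Ω (Ib Ω κ n : E × E → ℝ) = S.gradIb κ n := by
  funext γ
  have h : ∃ g, IsSympGradAt Ω (Ib Ω κ n) γ g := ⟨_, S.isSympGradAt_ib κ hn γ⟩
  rw [sympGrad, dif_pos h]
  exact S.omegaV_left_injective _ _
    fun δ => h.choose_spec.omegaV_eq_omegaV (S.isSympGradAt_ib κ hn γ) δ

include S in
theorem admissibleV_ib (κ : ℝ) {n : ℕ} (hn : 1 ≤ n) : AdmissibleV (E := E) Ω (Ib Ω κ n) := by
  have hq : PolynomialFamily S.mul 0 fun (γ : E × E) _ => γ.1 :=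
    .point (ContinuousLinearMap.fst ℝ E E)
  have hr : PolynomialFamily S.mul 0 fun (γ : E × E) _ => S.star γ.2 :=
    .point (S.star.comp (ContinuousLinearMap.snd ℝ E E))
  refine ⟨?_, fun γ => ⟨_, S.isSympGradAt_ib κ hn γ⟩, ?_⟩
  · rw [show Ib Ω κ n = _ from funext fun γ => S.ib_eq κ hn γ]
    have h := hr.mul (S.polynomialFamily_riccati κ hq hr (-Complex.I) n)
    exact ((h.gateauxSmooth S.continuous_mul).clm_comp S.integral).clm_comp Complex.reCLM
  · rw [S.sympGrad_ib κ hn]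
    exact (PolynomialFamily.gateauxSmooth S.continuous_mul
      ((S.polynomialFamily_bCoeff κ hq hr n).clm _)).prodMk
        (PolynomialFamily.gateauxSmooth S.continuous_mul
          (((S.polynomialFamily_aCoeff κ hq hr n).clm _).clm _))

include S in
-- Inserting the gradient of $I_{b,m}$ as direction into the differential of $I_{b,n}$ gives
-- $\mathrm{Re}\big(-i\int(a_nb_m-b_na_m)\big)$.
theorem poissonBracketV_ib (κ : ℝ) {n m : ℕ} (hn : 1 ≤ n) (hm : 1 ≤ m) (γ : E × E) :
    poissonBracketV Ω (Ib Ω κ n) (Ib Ω κ m) γ = 0 := by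
  rw [poissonBracketV, S.sympGrad_ib κ hn, S.sympGrad_ib κ hm, omegaV_gradIb]
  set a := S.aCoeff κ γ.1 (S.star γ.2) with ha
  set b := S.bCoeff κ γ.1 (S.star γ.2) with hb
  have h1 : S.mul (a n) (S.gradIb κ m γ).1 = S.const (-Complex.I) (S.mul (a n) (b m)) :=
    DFunLike.ext _ _ fun x => by
      simp only [gradIb, ← hb, S.mul_apply, S.const_apply]
      ring
  have h2 : S.mul (b n) (S.star (S.gradIb κ m γ).2) = S.const Complex.I (S.mul (b n) (a m)) :=
    DFunLike.ext _ _ fun x => by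
      simp only [gradIb, ← ha, S.mul_apply, S.const_apply, S.star_apply, map_mul, map_neg,
        Complex.conj_I, Complex.conj_conj]
      ring
  rw [h1, h2, map_add, integral_const, integral_const, ha, hb, S.integral_commutator]
  simp

theorem hierarchy (S : SmoothFunctionAlgebra E Ω) (κ : ℝ) :
    (∀ n : ℕ, 1 ≤ n → (∀ γ : E × E, IbComplex Ω κ n γ = (Ib Ω κ n γ : ℂ)) ∧
      AdmissibleV (E := E) Ω (Ib Ω κ n)) ∧
    ∀ n m : ℕ, 1 ≤ n → 1 ≤ m → ∀ γ : E × E,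
      poissonBracketV Ω (Ib Ω κ n) (Ib Ω κ m) γ = 0 :=
  ⟨fun n hn => ⟨fun γ => by rw [S.ib_eq κ hn, S.ibComplex_eq κ hn], S.admissibleV_ib κ hn⟩,
    fun _ _ hn hm γ => S.poissonBracketV_ib κ hn hm γ⟩

end SmoothFunctionAlgebra

/-! ## Continuity criteria in terms of seminorms -/

section Continuity

variable {E F ι : Type*} [AddCommGroup E] [Module ℝ E] [TopologicalSpace E]
  [IsTopologicalAddGroup E] [AddCommGroup F] [Module ℝ F] [TopologicalSpace F]
  {p : SeminormFamily ℝ F ι}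

theorem WithSeminorms.continuous_linear (hp : WithSeminorms p) (T : E →ₗ[ℝ] F)
    (hT : ∀ i, ∃ Φ : E → ℝ, Continuous Φ ∧ Φ 0 = 0 ∧ ∀ f, p i (T f) ≤ Φ f) : Continuous T := by
  refine continuous_iff_continuousAt.2 fun f₀ => (hp.tendsto_nhds _ _).2 fun i ε hε => ?_
  obtain ⟨Φ, hΦ, hΦ0, hle⟩ := hT i
  have h : Tendsto (fun f => Φ (f - f₀)) (𝓝 f₀) (𝓝 0) := by
    have h := (hΦ.comp (continuous_sub_right f₀)).tendsto f₀
    simpa [Function.comp_def, hΦ0] using h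
  filter_upwards [h.eventually_lt_const hε] with f hf
  rw [← map_sub]
  exact (hle _).trans_lt hf

/-- The increment splits as $B(x_1-x_{0,1},x_2)+B(x_{0,1},x_2-x_{0,2})$, and a continuous majorant
vanishing on both axes controls each part. -/
theorem WithSeminorms.continuous_bilinear (hp : WithSeminorms p) (B : E →ₗ[ℝ] E →ₗ[ℝ] F)
    (hB : ∀ i, ∃ Φ : E × E → ℝ, Continuous Φ ∧ (∀ f, Φ (f, 0) = 0) ∧ (∀ g, Φ (0, g) = 0) ∧
      ∀ f g, p i (B f g) ≤ Φ (f, g)) :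
    Continuous fun x : E × E => B x.1 x.2 := by
  refine continuous_iff_continuousAt.2 fun x₀ => (hp.tendsto_nhds _ _).2 fun i ε hε => ?_
  obtain ⟨Φ, hΦ, hΦ1, hΦ2, hle⟩ := hB i
  have h : Tendsto (fun x : E × E => Φ (x.1 - x₀.1, x.2) + Φ (x₀.1, x.2 - x₀.2)) (𝓝 x₀) (𝓝 0) := by
    have h : Continuous fun x : E × E => Φ (x.1 - x₀.1, x.2) + Φ (x₀.1, x.2 - x₀.2) :=
      (hΦ.comp ((continuous_fst.sub continuous_const).prodMk continuous_snd)).add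
        (hΦ.comp (continuous_const.prodMk (continuous_snd.sub continuous_const)))
    simpa [hΦ1, hΦ2] using h.tendsto x₀
  filter_upwards [h.eventually_lt_const hε] with x hx
  have hsplit : B x.1 x.2 - B x₀.1 x₀.2 = B (x.1 - x₀.1) x.2 + B x₀.1 (x.2 - x₀.2) := by
    simp only [map_sub, LinearMap.sub_apply]
    abel
  rw [hsplit]
  exact ((map_add_le_add _ _ _).trans (add_le_add (hle _ _) (hle _ _))).trans_lt hx

end Continuity

/-! ### Iterated derivatives of products and conjugates -/

theorem norm_iteratedDeriv_mul_le {f g : ℝ → ℂ} (hf : ContDiff ℝ ∞ f) (hg : ContDiff ℝ ∞ g) (k : ℕ)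
    (x : ℝ) : ‖iteratedDeriv k (fun x => f x * g x) x‖ ≤ ∑ j ∈ Finset.range (k + 1),
      (k.choose j : ℝ) * ‖iteratedDeriv j f x‖ * ‖iteratedDeriv (k - j) g x‖ := by
  have hk : (k : ℕ∞ω) ≤ ∞ := by exact_mod_cast le_top
  rw [iteratedDeriv_fun_mul (hf.contDiffAt.of_le hk) (hg.contDiffAt.of_le hk)]
  refine (norm_sum_le _ _).trans (Finset.sum_le_sum fun j _ => ?_)
  rw [norm_mul, norm_mul, Complex.norm_natCast]

theorem iteratedDeriv_conj {f : ℝ → ℂ} (hf : ContDiff ℝ ∞ f) (k : ℕ) (x : ℝ) :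
    iteratedDeriv k (fun x => conj (f x)) x = conj (iteratedDeriv k f x) := by
  induction k generalizing x with
  | zero => simp
  | succ k ih =>
    rw [iteratedDeriv_succ, iteratedDeriv_succ, funext ih]
    have h : HasDerivAt (iteratedDeriv k f) (deriv (iteratedDeriv k f) x) x :=
      (hf.differentiable_iteratedDeriv k (by exact_mod_cast WithTop.coe_lt_top _) x).hasDerivAt
    exact h.star.deriv

/-! ## Schwartz functions -/

namespace SchwartzMap

/-- The pointwise product of Schwartz functions. -/
def mulBilin : 𝓢(ℝ, ℂ) →ₗ[ℝ] 𝓢(ℝ, ℂ) →ₗ[ℝ] 𝓢(ℝ, ℂ) :=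
  LinearMap.mk₂ ℝ (fun f g => pairing (ContinuousLinearMap.mul ℝ ℂ) f g)
    (fun f f' g => by rw [map_add, add_apply])
    (fun c f g => by rw [map_smul, smul_apply])
    (fun f g g' => by rw [map_add]) (fun c f g => by rw [map_smul])

theorem mulBilin_apply (f g : 𝓢(ℝ, ℂ)) (x : ℝ) : mulBilin f g x = f x * g x := rfl

theorem continuous_mulBilin : Continuous fun p : 𝓢(ℝ, ℂ) × 𝓢(ℝ, ℂ) => mulBilin p.1 p.2 := by
  have hs : WithSeminorms (schwartzSeminormFamily ℝ ℝ ℂ) := schwartz_withSeminorms ℝ ℝ ℂ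
  -- The majorant is the Leibniz bound with the whole polynomial weight placed on the first factor.
  refine hs.continuous_bilinear _ fun i => ⟨fun p => ∑ j ∈ Finset.range (i.2 + 1),
    (i.2.choose j : ℝ) * SchwartzMap.seminorm ℝ i.1 j p.1 *
      SchwartzMap.seminorm ℝ 0 (i.2 - j) p.2, ?_, ?_, ?_, ?_⟩
  · exact continuous_finsetSum _ fun j _ =>
      ((continuous_const.mul ((hs.continuous_seminorm (i.1, j)).comp continuous_fst)).mul
        ((hs.continuous_seminorm (0, i.2 - j)).comp continuous_snd))
  · intro f
    simp
  · intro g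
    simp
  · intro f g
    refine seminorm_le_bound' ℝ i.1 i.2 _ (Finset.sum_nonneg fun j _ => by positivity) fun x => ?_
    refine (mul_le_mul_of_nonneg_left
      (norm_iteratedDeriv_mul_le (f.smooth ⊤) (g.smooth ⊤) i.2 x) (by positivity)).trans ?_
    rw [Finset.mul_sum]
    refine Finset.sum_le_sum fun j _ => ?_
    have h1 := f.le_seminorm' ℝ i.1 j x
    have h2 := g.le_seminorm' ℝ 0 (i.2 - j) x
    rw [pow_zero, one_mul] at h2
    calc |x| ^ i.1 * (i.2.choose j * ‖iteratedDeriv j f x‖ * ‖iteratedDeriv (i.2 - j) g x‖)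
        = i.2.choose j * (|x| ^ i.1 * ‖iteratedDeriv j f x‖) * ‖iteratedDeriv (i.2 - j) g x‖ := by
          ring
      _ ≤ _ := by gcongr

/-- The operations on Schwartz functions. -/
def smoothFunctionAlgebra : SmoothFunctionAlgebra 𝓢(ℝ, ℂ) Set.univ where
  coe_add _ _ _ := rfl
  coe_smul c f x := Complex.real_smul
  differentiable f := f.differentiable
  mul := mulBilin
  mul_apply := mulBilin_apply
  continuous_mul := continuous_mulBilin
  der := derivCLM ℝ ℂ
  der_apply := derivCLM_apply ℝ
  star := postcompCLM (Complex.conjCLE : ℂ →L[ℝ] ℂ)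
  star_apply _ _ := rfl
  const c := postcompCLM (ContinuousLinearMap.mul ℝ ℂ c)
  const_apply _ _ _ := rfl
  integral := integralCLM ℝ volume
  integral_apply f := by rw [integralCLM_apply, setIntegral_univ]
  integrableOn f := f.integrable.integrableOn
  integral_der f := by
    rw [integralCLM_apply]
    exact integral_eq_zero_of_hasDerivAt_of_integrable f.hasDerivAt
      (derivCLM ℝ ℂ f).integrable f.integrable
  omegaV_left_injective _ _ := schwartz_omegaV_left_injective

end SchwartzMap

/-! ## Smooth periodic functions -/

namespace PeriodicSmooth

variable {L : ℝ}

theorem isTopologicalAddGroup [Fact (0 < L)] : IsTopologicalAddGroup (PeriodicSmooth L) :=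
  withSeminorms.topologicalAddGroup

theorem continuousSMul [Fact (0 < L)] : ContinuousSMul ℝ (PeriodicSmooth L) :=
  withSeminorms.continuousSMul

theorem norm_iteratedDeriv_le [Fact (0 < L)] (f : PeriodicSmooth L) (k : ℕ) (x : ℝ) :
    ‖iteratedDeriv k f x‖ ≤ supSeminorm k f :=
  le_ciSup (f.bddAbove_iteratedDeriv k) x

theorem supSeminorm_le [Fact (0 < L)] {f : PeriodicSmooth L} {k : ℕ} {M : ℝ}
    (h : ∀ x, ‖iteratedDeriv k f x‖ ≤ M) : supSeminorm k f ≤ M :=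
  ciSup_le h

/-- The pointwise product of periodic functions. -/
def mulBilin : PeriodicSmooth L →ₗ[ℝ] PeriodicSmooth L →ₗ[ℝ] PeriodicSmooth L :=
  LinearMap.mk₂ ℝ (fun f g => ⟨fun x => f x * g x, f.contDiff.mul g.contDiff,
      f.periodic.mul g.periodic⟩)
    (fun f f' g => DFunLike.ext _ _ fun x => add_mul (f x) (f' x) (g x))
    (fun c f g => DFunLike.ext _ _ fun x => smul_mul_assoc c (f x) (g x))
    (fun f g g' => DFunLike.ext _ _ fun x => mul_add (f x) (g x) (g' x))
    (fun c f g => DFunLike.ext _ _ fun x => mul_smul_comm c (f x) (g x))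

theorem mulBilin_apply (f g : PeriodicSmooth L) (x : ℝ) : mulBilin f g x = f x * g x := rfl

theorem continuous_mulBilin [Fact (0 < L)] :
    Continuous fun p : PeriodicSmooth L × PeriodicSmooth L => mulBilin p.1 p.2 := by
  have := isTopologicalAddGroup (L := L)
  have hs := withSeminorms (L := L)
  refine hs.continuous_bilinear _ fun k => ⟨fun p => ∑ j ∈ Finset.range (k + 1),
    (k.choose j : ℝ) * supSeminorm j p.1 * supSeminorm (k - j) p.2, ?_, ?_, ?_, ?_⟩
  · exact continuous_finsetSum _ fun j _ =>
      ((continuous_const.mul ((hs.continuous_seminorm j).comp continuous_fst)).mul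
        ((hs.continuous_seminorm (k - j)).comp continuous_snd))
  · intro f
    simp
  · intro g
    simp
  · intro f g
    refine supSeminorm_le fun x => (norm_iteratedDeriv_mul_le f.contDiff g.contDiff k x).trans ?_
    refine Finset.sum_le_sum fun j _ => ?_
    gcongr
    · exact f.norm_iteratedDeriv_le j x
    · exact g.norm_iteratedDeriv_le (k - j) x

/-- Here $l$ is the loss of derivatives: 1 for $\partial_x$, 0 for conjugation and for
multiplication by constants. -/
theorem continuous_of_supSeminorm_le [Fact (0 < L)] (T : PeriodicSmooth L →ₗ[ℝ] PeriodicSmooth L)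
    (c : ℝ) (l : ℕ) (hT : ∀ k f, supSeminorm k (T f) ≤ c * supSeminorm (k + l) f) :
    Continuous T := by
  have := isTopologicalAddGroup (L := L)
  have hs := withSeminorms (L := L)
  exact hs.continuous_linear T fun k => ⟨fun f => c * supSeminorm (k + l) f,
    continuous_const.mul (hs.continuous_seminorm (k + l)), by simp, hT k⟩

/-- The derivative of periodic functions, as a linear map. -/
def derLM : PeriodicSmooth L →ₗ[ℝ] PeriodicSmooth L where
  toFun f := ⟨deriv f, (contDiff_infty_iff_deriv.1 f.contDiff).2, by
    simpa only [iteratedDeriv_one] using f.periodic_iteratedDeriv 1⟩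
  map_add' f g := DFunLike.ext _ _ fun x => deriv_add
    (f.contDiff.differentiable (by simp) x) (g.contDiff.differentiable (by simp) x)
  map_smul' c f := DFunLike.ext _ _ fun x => deriv_const_smul c
    (f.contDiff.differentiable (by simp) x)

theorem coe_derLM (f : PeriodicSmooth L) : ⇑(derLM f) = deriv f := rfl

/-- The derivative of periodic functions. -/
def derCLM [Fact (0 < L)] : PeriodicSmooth L →L[ℝ] PeriodicSmooth L where
  toLinearMap := derLM
  cont := continuous_of_supSeminorm_le derLM 1 1 fun k f => supSeminorm_le fun x => by
    rw [one_mul, coe_derLM, ← iteratedDeriv_succ']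
    exact f.norm_iteratedDeriv_le (k + 1) x

/-- The complex conjugation of periodic functions, as a linear map. -/
def starLM : PeriodicSmooth L →ₗ[ℝ] PeriodicSmooth L where
  toFun f := ⟨fun x => conj (f x), Complex.conjCLE.contDiff.comp f.contDiff,
    fun x => congrArg conj (f.periodic x)⟩
  map_add' f g := DFunLike.ext _ _ fun x => map_add (starRingEnd ℂ) (f x) (g x)
  map_smul' c f := DFunLike.ext _ _ fun x => map_smul Complex.conjCLE c (f x)

theorem coe_starLM (f : PeriodicSmooth L) : ⇑(starLM f) = fun x => conj (f x) := rfl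

/-- The complex conjugation of periodic functions. -/
def starCLM [Fact (0 < L)] : PeriodicSmooth L →L[ℝ] PeriodicSmooth L where
  toLinearMap := starLM
  cont := continuous_of_supSeminorm_le starLM 1 0 fun k f => supSeminorm_le fun x => by
    rw [one_mul, coe_starLM, iteratedDeriv_conj f.contDiff, Complex.norm_conj]
    exact f.norm_iteratedDeriv_le k x

/-- The multiplication of periodic functions by a complex constant, as a linear map. -/
def constLM (c : ℂ) : PeriodicSmooth L →ₗ[ℝ] PeriodicSmooth L where
  toFun f := ⟨fun x => c * f x, contDiff_const.mul f.contDiff,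
    fun x => congrArg (c * ·) (f.periodic x)⟩
  map_add' f g := DFunLike.ext _ _ fun x => mul_add c (f x) (g x)
  map_smul' a f := DFunLike.ext _ _ fun x => mul_smul_comm a c (f x)

theorem coe_constLM (c : ℂ) (f : PeriodicSmooth L) : ⇑(constLM c f) = fun x => c * f x := rfl

/-- The multiplication of periodic functions by a complex constant. -/
def constCLM [Fact (0 < L)] (c : ℂ) : PeriodicSmooth L →L[ℝ] PeriodicSmooth L where
  toLinearMap := constLM c
  cont := continuous_of_supSeminorm_le (constLM c) ‖c‖ 0 fun k f => supSeminorm_le fun x => by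
    rw [coe_constLM, iteratedDeriv_const_mul_field, norm_mul]
    exact mul_le_mul_of_nonneg_left (f.norm_iteratedDeriv_le k x) (norm_nonneg c)

theorem integrableOn (f : PeriodicSmooth L) : IntegrableOn f (Set.Ioc (-L) L) :=
  f.contDiff.continuous.integrableOn_Ioc

/-- The integral of periodic functions over one period, as a linear map. -/
def integralLM : PeriodicSmooth L →ₗ[ℝ] ℂ where
  toFun f := ∫ x in Set.Ioc (-L) L, f x
  map_add' f g := integral_add f.integrableOn g.integrableOn
  map_smul' c f := integral_smul c f

/-- The integral of periodic functions over one period. -/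
def integralCLM [Fact (0 < L)] : PeriodicSmooth L →L[ℝ] ℂ where
  toLinearMap := integralLM
  cont := by
    have := isTopologicalAddGroup (L := L)
    refine (norm_withSeminorms ℝ ℂ).continuous_linear integralLM fun _ =>
      ⟨fun f => supSeminorm 0 f * volume.real (Set.Ioc (-L) L),
        (withSeminorms.continuous_seminorm 0).mul continuous_const, by simp, fun f => ?_⟩
    change ‖∫ x in Set.Ioc (-L) L, f x‖ ≤ _
    exact norm_setIntegral_le_of_norm_le_const measure_Ioc_lt_top fun x _ => by
      simpa using f.norm_iteratedDeriv_le 0 x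

/-- The operations on smooth periodic functions. -/
def smoothFunctionAlgebra [hL : Fact (0 < L)] :
    SmoothFunctionAlgebra (PeriodicSmooth L) (Set.Ioc (-L) L) where
  coe_add _ _ _ := rfl
  coe_smul c f x := Complex.real_smul
  differentiable f := f.contDiff.differentiable (by simp)
  mul := mulBilin
  mul_apply := mulBilin_apply
  continuous_mul := continuous_mulBilin
  der := derCLM
  der_apply _ _ := rfl
  star := starCLM
  star_apply _ _ := rfl
  const := constCLM
  const_apply _ _ _ := rfl
  integral := integralCLM
  integral_apply _ := rfl
  integrableOn := integrableOn
  integral_der f := by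
    have hle : -L ≤ L := by linarith [hL.out]
    have hp := f.periodic (-L)
    rw [show -L + 2 * L = L by ring] at hp
    change ∫ x in Set.Ioc (-L) L, deriv f x = 0
    rw [← intervalIntegral.integral_of_le hle, intervalIntegral.integral_deriv_eq_sub
      (fun x _ => f.contDiff.differentiable (by simp) x)
      ((derCLM f).contDiff.continuous.intervalIntegrable _ _), hp, sub_self]
  omegaV_left_injective _ _ := periodic_omegaV_left_injective hL.out

end PeriodicSmooth

end

theorem propositionA12 (κ : ℝ) (hκ : κ = 1 ∨ κ = -1) :
    -- smooth functions on the circle of length `2L`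
    (∀ (L : ℝ) [Fact (0 < L)],
      (∀ n : ℕ, 1 ≤ n →
        (∀ γ : PeriodicSmooth L × PeriodicSmooth L,
          IbComplex (Set.Ioc (-L) L) κ n γ = (Ib (Set.Ioc (-L) L) κ n γ : ℂ)) ∧
        AdmissibleV (E := PeriodicSmooth L) (Set.Ioc (-L) L) (Ib (Set.Ioc (-L) L) κ n)) ∧
      ∀ n m : ℕ, 1 ≤ n → 1 ≤ m → ∀ γ : PeriodicSmooth L × PeriodicSmooth L,
        poissonBracketV (Set.Ioc (-L) L)
          (Ib (Set.Ioc (-L) L) κ n) (Ib (Set.Ioc (-L) L) κ m) γ = 0) ∧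
    -- Schwartz functions on the line
    ((∀ n : ℕ, 1 ≤ n →
        (∀ γ : 𝓢(ℝ, ℂ) × 𝓢(ℝ, ℂ),
          IbComplex Set.univ κ n γ = (Ib Set.univ κ n γ : ℂ)) ∧
        AdmissibleV (E := 𝓢(ℝ, ℂ)) Set.univ (Ib Set.univ κ n)) ∧
      ∀ n m : ℕ, 1 ≤ n → 1 ≤ m → ∀ γ : 𝓢(ℝ, ℂ) × 𝓢(ℝ, ℂ),
        poissonBracketV Set.univ (Ib Set.univ κ n) (Ib Set.univ κ m) γ = 0) := by
  refine ⟨fun L _ => ?_, SchwartzMap.smoothFunctionAlgebra.hierarchy κ⟩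
  have := PeriodicSmooth.isTopologicalAddGroup (L := L)
  have := PeriodicSmooth.continuousSMul (L := L)
  exact PeriodicSmooth.smoothFunctionAlgebra.hierarchy κ
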